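/- Let $N\ge 0$ and $q\ge 1$ be integers and let $\Sigma$ be a non-empty finite set (the digits). A Sudoku rule of width $N$ is a set $\mathcal S$ of functions $\{0,\dots,N-1\}\to\Sigma$, and an initial condition of period $q$ is a set $\mathcal C\subset(\mathbb Z/q\mathbb Z)\times\Sigma$. The $(\mathcal S,\mathcal C)$-Sudoku puzzle is called solvable if there is a function $F\colon\{0,\dots,N-1\}\times\mathbb Z\to\Sigma$ such that - for all $j,i\in\mathbb Z$ the function $n\mapsto F(n,jn+i)$ lies in $\mathcal S$, and - for every $n\in\{0,\dots,N-1\}$ there is a permutation $\sigma_n$ of $\mathbb Z/q\mathbb Z$ such that $(\sigma_n(m \bmod q),F(n,m))\in\mathcal C$ for all $m\in\mathbb Z$. For an Abelian group $G$ and sets $F,E\subset G$, we say that $F$ tiles $E$ if there is a set $A\subset G$ with $A\oplus F=E$, that is, all sums $a+f$ with $a\in A$, $f\in F$ lie in $E$ and every element of $E$ is equal to $a+f$ for exactly one pair $(a,f)\in A\times F$. **Theorem.** There is an algorithm (a computable function) which, given (a finite description of) any Sudoku rule $\mathcal S$ and any initial condition $\mathcal C$ as above, outputs in finite time a finite Abelian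 group $G_0$ (given as a product of finite cyclic groups), a set $E\subset G_0$ and a finite set $F\subset\mathbb Z^2\times G_0$ such that the $(\mathcal S,\mathcal C)$-Sudoku puzzle is solvable if and only if $F$ tiles $\mathbb Z^2\times E$. -/

import Mathlib

/-! ## Sudoku puzzles

The Sudoku board of width `N` is `Fin N × ℤ`. -/

/-- A Sudoku rule of width `N` and digit set `Digit`: a collection of functions
`{0, …, N - 1} → Digit`. -/
abbrev SudokuRule (N : ℕ) (Digit : Type*) := Set (Fin N → Digit)

/-- An initial condition of period `q`: a subset of `ℤ/qℤ × Digit`. -/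
abbrev InitialCondition (q : ℕ) (Digit : Type*) := Set (ZMod q × Digit)

/-- `F` is a solution of the Sudoku rule `S`: the restriction of `F` to every non-vertical line
`{(n, j n + i) : 0 ≤ n < N}` with `j, i ∈ ℤ`, parametrized by `n`, lies in `S`. -/
def IsSudokuSolution {N : ℕ} {Digit : Type*} (S : SudokuRule N Digit)
    (F : Fin N × ℤ → Digit) : Prop :=
  ∀ j i : ℤ, (fun n : Fin N => F (n, j * ((n : ℕ) : ℤ) + i)) ∈ S

/-- `F` obeys the initial condition `C`: for every column `n` there is a permutation `σ` of
`ℤ/qℤ` with `(σ (m mod q), F (n, m)) ∈ C` for all `m`. -/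
def ObeysInitialCondition {N q : ℕ} {Digit : Type*} (C : InitialCondition q Digit)
    (F : Fin N × ℤ → Digit) : Prop :=
  ∀ n : Fin N, ∃ σ : Equiv.Perm (ZMod q), ∀ m : ℤ, (σ (m : ZMod q), F (n, m)) ∈ C

/-- The `(S, C)`-Sudoku puzzle is solvable. -/
def SudokuSolvable {N q : ℕ} {Digit : Type*} (S : SudokuRule N Digit)
    (C : InitialCondition q Digit) : Prop :=
  ∃ F : Fin N × ℤ → Digit, IsSudokuSolution S F ∧ ObeysInitialCondition C F

/-! ## Translational monotilings -/

/-- `F` tiles `E` by translations: there is a set `A` with `A ⊕ F = E`, that is, all the sums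
`a + f` with `a ∈ A`, `f ∈ F` lie in `E`, and each point of `E` is such a sum in exactly
one way. -/
def Tiles {G : Type*} [AddCommGroup G] (F E : Set G) : Prop :=
  ∃ A : Set G, Set.BijOn (fun p : G × G => p.1 + p.2) (A ×ˢ F) E

/-! ## Inputs of the algorithm -/

/-- A finite description of a Sudoku rule and of an initial condition, with the digits numbered
`0, …, numDigits - 1`. -/
structure SudokuCode where
  /-- The width `N`. -/
  width : ℕ
  /-- The number of digits. -/
  numDigits : ℕ
  /-- The period `q`. -/
  period : ℕ
  /-- The list of the members `g` of the rule, each written as `[g 0, …, g (N - 1)]`. -/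
  rule : List (List ℕ)
  /-- The list of the members of the initial condition. -/
  init : List (ℕ × ℕ)

/-- A Sudoku description as a tuple. -/
def SudokuCode.equivTuple :
    SudokuCode ≃ ℕ × ℕ × ℕ × List (List ℕ) × List (ℕ × ℕ) where
  toFun c := (c.width, c.numDigits, c.period, c.rule, c.init)
  invFun t := ⟨t.1, t.2.1, t.2.2.1, t.2.2.2.1, t.2.2.2.2⟩
  left_inv _ := rfl
  right_inv _ := rfl

instance SudokuCode.instPrimcodable : Primcodable SudokuCode :=
  Primcodable.ofEquiv _ SudokuCode.equivTuple

/-- `c` describes the Sudoku rule `S` of width `N` and the initial condition `C` of period `q`,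
for some numbering `e` of the digits. -/
def SudokuCode.Describes {N q : ℕ} {Digit : Type*} (c : SudokuCode) (S : SudokuRule N Digit)
    (C : InitialCondition q Digit) : Prop :=
  c.width = N ∧ c.period = q ∧ ∃ e : Digit ≃ Fin c.numDigits,
    (∀ g : Fin N → Digit, g ∈ S ↔ List.ofFn (fun n => (e (g n) : ℕ)) ∈ c.rule) ∧
    (∀ (r : ZMod q) (d : Digit), (r, d) ∈ C ↔ (r.val, (e d : ℕ)) ∈ c.init)

/-- Every Sudoku rule and initial condition over a finite digit set has a description. -/
theorem SudokuCode.exists_describes {N q : ℕ} (hq : 1 ≤ q) {Digit : Type*} [Finite Digit]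
    (S : SudokuRule N Digit) (C : InitialCondition q Digit) :
    ∃ c : SudokuCode, c.Describes S C := by
  have : NeZero q := ⟨by omega⟩
  let e := Finite.equivFin Digit
  let w : (Fin N → Digit) → List ℕ := fun g => List.ofFn (fun n => (e (g n) : ℕ))
  let v : ZMod q × Digit → ℕ × ℕ := fun p => (p.1.val, (e p.2 : ℕ))
  have hw : Function.Injective w := by
    intro g h hgh
    funext n
    exact e.injective (Fin.ext (congrFun (List.ofFn_injective hgh) n))
  have hv : Function.Injective v := by
    rintro ⟨r, d⟩ ⟨r', d'⟩ h
    have h1 : r.val = r'.val := congrArg Prod.fst h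
    have h2 : (e d : ℕ) = e d' := congrArg Prod.snd h
    rw [ZMod.val_injective q h1, e.injective (Fin.ext h2)]
  refine ⟨⟨N, Nat.card Digit, q, ((Set.toFinite S).toFinset.toList.map w),
    ((Set.toFinite C).toFinset.toList.map v)⟩, rfl, rfl, e, fun g => ?_, fun r d => ?_⟩
  · change g ∈ S ↔ w g ∈ List.map w _
    rw [List.mem_map_of_injective hw]
    simp
  · change (r, d) ∈ C ↔ v (r, d) ∈ List.map v _
    rw [List.mem_map_of_injective hv]
    simp

/-! ## Outputs of the algorithm -/

/-- A finite description of an Abelian group `G₀`, a set `E ⊆ G₀` and a finite set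
`F ⊆ ℤ² × G₀`. -/
structure TilingCode where
  /-- The moduli `[m₁, …, mᵣ]` of the group `G₀ = ℤ/m₁ℤ × ⋯ × ℤ/mᵣℤ`. -/
  moduli : List ℕ
  /-- The list of the elements of `E`, each written through representatives of its residues. -/
  region : List (List ℕ)
  /-- The list of the elements of `F`, the second component written in the same way. -/
  tile : List ((ℤ × ℤ) × List ℕ)

/-- A tiling description as a tuple. -/
def TilingCode.equivTuple :
    TilingCode ≃ List ℕ × List (List ℕ) × List ((ℤ × ℤ) × List ℕ) where
  toFun t := (t.moduli, t.region, t.tile)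
  invFun t := ⟨t.1, t.2.1, t.2.2⟩
  left_inv _ := rfl
  right_inv _ := rfl

instance TilingCode.instPrimcodable : Primcodable TilingCode :=
  Primcodable.ofEquiv _ TilingCode.equivTuple

/-- The Abelian group `G₀`. It is finite if and only if all the moduli are positive. -/
abbrev TilingCode.G₀ (t : TilingCode) : Type :=
  (i : Fin t.moduli.length) → ZMod (t.moduli.get i)

/-- The element of `G₀` with the residues of the numbers in the list `l` as its coordinates. -/
def TilingCode.element (t : TilingCode) (l : List ℕ) : t.G₀ :=
  fun i => ((l.getD i 0 : ℕ) : ZMod (t.moduli.get i))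

/-- The set `E ⊆ G₀`. -/
def TilingCode.E (t : TilingCode) : Set t.G₀ :=
  {g | ∃ l ∈ t.region, g = t.element l}

/-- The set `F ⊆ ℤ² × G₀`. -/
def TilingCode.F (t : TilingCode) : Set ((ℤ × ℤ) × t.G₀) :=
  {x | ∃ p ∈ t.tile, x = (p.1, t.element p.2)}

/-!
The proof encodes a Sudoku puzzle by functional equations on `ℤ²`, and those by tiling equations.

A function `F` on the board is recorded by the functions `f_n(i, j) = F(n, i - j n)` on `ℤ²`. Such
families are exactly the ones in which `f_n` is invariant under the translation by `(n, 1)`, and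
then `(f_n(x))_n` is the restriction of `F` to a line, so that the rule becomes a pointwise
membership condition. The permutation of a column is carried along as a second component `r_n` of
`f_n` with values in `ℤ/qℤ`, which takes every value once on each horizontal segment of length `q`
(`exists_perm_of_windows`); the initial condition is again a pointwise membership condition. The
pairs `(r_n, f_n)` are coded in `K = ℤ/Lℤ` with `q ∣ L`, so that the puzzle asks for a function
`U : ℤ² → K ^ N` (`sudokuSolvable_iff`).

The functional equations are tiling equations for the graph of `U` (`isTiling_invariantTile_iff`,
`isTiling_permutationTile_iff`). Several tiling equations with one unknown are merged into one by
an additional coordinate in `ℤ/Lℤ`, since a window of a cyclic group admits no other translation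
into itself than the trivial one (`tiles_layers_iff`).

A single tiling equation for a graph cannot express the membership `U x ∈ S`, as all translates of
a tile look alike. Therefore `U` is replaced by functions indexed by `k₁, k₂ ∈ K` and an offset
`h ∈ K ^ N`, all subject to the same functional equations, and each point of the graph carries a
mark `(t₁, t₂) ∈ K²`. One more tiling equation (the column equation) forces `t₁ = k₂` if `h = 0`
and `t₁ + t₂ = k₂` if `h ≠ 0`; another (the row equation) forces `t₂ = k₁` if the value lies in `S`
and `t₁ = k₁` otherwise. At `h = 0` and `k₁ ≠ k₂` this leaves no mark for a value outside `S`
(`exists_function_of_isTiling`). Conversely, if `U` takes values in `S`, the functions `U + h`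
solve all the equations: in each of the three remaining combinations the two conditions leave
exactly one mark for each `(k₁, k₂)`, and the marks of a row or of a column exhaust what the region
prescribes (`exists_isTiling_of_function`).

In the output all the moduli equal `L`. The region and the tile are obtained by testing every
bounded list of coordinates with a predicate that is primitive recursive in the puzzle
(`SudokuCode.computable_toTilingCode`).
-/

/-! ### Systems of tiling equations -/

/-- `A ⊕ F = E`: every sum `a + f` with `a ∈ A`, `f ∈ F` lies in `E`, and every point of `E` is
such a sum in exactly one way. -/
def IsTiling {G : Type*} [AddCommGroup G] (A F E : Set G) : Prop :=
  Set.BijOn (fun p : G × G => p.1 + p.2) (A ×ˢ F) E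

theorem isTiling_iff {G : Type*} [AddCommGroup G] {A F E : Set G} :
    IsTiling A F E ↔
      (∀ a ∈ A, ∀ f ∈ F, a + f ∈ E) ∧ ∀ y ∈ E, ∃! f, f ∈ F ∧ y - f ∈ A := by
  constructor
  · rintro ⟨hm, hi, hs⟩
    refine ⟨fun a ha f hf => hm (Set.mk_mem_prod ha hf), fun y hy => ?_⟩
    obtain ⟨⟨a, f⟩, ⟨ha, hf⟩, rfl⟩ := hs hy
    refine ⟨f, ⟨hf, by simpa using ha⟩, fun f' hf' => ?_⟩
    have := hi (Set.mk_mem_prod hf'.2 hf'.1) (Set.mk_mem_prod ha hf) (by simp)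
    exact (Prod.ext_iff.1 this).2
  · rintro ⟨hm, hu⟩
    refine ⟨fun p hp => hm _ hp.1 _ hp.2, ?_, fun y hy => ?_⟩
    · rintro ⟨a, f⟩ ⟨ha, hf⟩ ⟨a', f'⟩ ⟨ha', hf'⟩ h
      dsimp only at ha hf ha' hf' h
      have h1 : f = f' := (hu _ (hm a ha f hf)).unique ⟨hf, by simpa using ha⟩
        ⟨hf', by rw [h]; simpa using ha'⟩
      subst h1
      rw [add_right_cancel h]
    · obtain ⟨f, hf, -⟩ := hu y hy
      exact ⟨(y - f, f), ⟨hf.2, hf.1⟩, by simp⟩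

theorem isTiling_preimage {G H : Type*} [AddCommGroup G] [AddCommGroup H] (φ : G ≃+ H)
    {A F E : Set H} (h : IsTiling A F E) : IsTiling (φ ⁻¹' A) (φ ⁻¹' F) (φ ⁻¹' E) := by
  rw [isTiling_iff] at h ⊢
  refine ⟨fun a ha f hf => by simpa using h.1 _ ha _ hf, fun y hy => ?_⟩
  obtain ⟨f, hf, hu⟩ := h.2 _ hy
  refine ⟨φ.symm f, ⟨by simpa using hf.1, by simpa using hf.2⟩, fun f' hf' => ?_⟩
  rw [← hu (φ f') ⟨hf'.1, by simpa using hf'.2⟩, φ.symm_apply_apply]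

theorem tiles_preimage_iff {G H : Type*} [AddCommGroup G] [AddCommGroup H] (φ : G ≃+ H)
    {F E : Set H} : Tiles (φ ⁻¹' F) (φ ⁻¹' E) ↔ Tiles F E := by
  constructor
  · rintro ⟨A, hA⟩
    have := isTiling_preimage φ.symm hA
    refine ⟨φ.symm ⁻¹' A, ?_⟩
    change IsTiling _ _ _
    simpa [← Set.preimage_comp, Function.comp_def] using this
  · rintro ⟨A, hA⟩
    exact ⟨φ ⁻¹' A, isTiling_preimage φ hA⟩

/-- A window `{0, …, M - 1}` of `ℤ/Lℤ` with `0 < M < L` is mapped into itself by no translation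
but the trivial one. -/
theorem ZMod.eq_zero_of_add_val_lt {L M : ℕ} (hM : 0 < M) (hL : M < L) (s : ZMod L)
    (h : ∀ i < M, (s + (i : ZMod L)).val < M) : s = 0 := by
  have : NeZero L := ⟨by omega⟩
  by_contra hs
  have h0 := h 0 hM
  rw [Nat.cast_zero, add_zero] at h0
  have hpos : 0 < s.val := Nat.pos_of_ne_zero fun h => hs ((ZMod.val_eq_zero s).1 h)
  have h1 := h (M - s.val) (by omega)
  -- the window point `M - s` is moved to `M`, just outside the window
  have h2 : s + ((M - s.val : ℕ) : ZMod L) = (M : ℕ) := by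
    conv_lhs => rw [← ZMod.natCast_zmod_val s]
    rw [← Nat.cast_add]
    congr 1
    rw [ZMod.natCast_zmod_val]
    omega
  rw [h2, ZMod.val_natCast_of_lt hL] at h1
  omega

/-- A system of fewer than `L` tiling equations `A ⊕ F i = E i` with a common unknown `A` is one
tiling problem in the product with `ℤ/Lℤ`, the `i`-th equation being put on the layer `i`. -/
theorem tiles_layers_iff {G : Type*} [AddCommGroup G] {L M : ℕ} (hM : 0 < M) (hL : M < L)
    (F E : ℕ → Set G) (hF : ∀ i < M, 0 ∈ F i) :
    Tiles {p : ZMod L × G | p.1.val < M ∧ p.2 ∈ F p.1.val}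
        {p : ZMod L × G | p.1.val < M ∧ p.2 ∈ E p.1.val} ↔
      ∃ A : Set G, ∀ i < M, IsTiling A (F i) (E i) := by
  have : NeZero L := ⟨by omega⟩
  have hval : ∀ i < M, ((i : ℕ) : ZMod L).val = i := fun i hi =>
    ZMod.val_natCast_of_lt (hi.trans hL)
  constructor
  · rintro ⟨A, hA⟩
    replace hA := isTiling_iff.1 hA
    have hA0 : ∀ a ∈ A, a.1 = 0 := fun a ha => by
      refine ZMod.eq_zero_of_add_val_lt hM hL _ fun i hi => ?_
      exact (hA.1 a ha ((i : ℕ), 0) ⟨by rwa [hval i hi], by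
        dsimp only; rw [hval i hi]; exact hF i hi⟩).1
    refine ⟨{g | ((0 : ZMod L), g) ∈ A}, fun i hi => isTiling_iff.2 ⟨fun a ha f hf => ?_,
      fun y hy => ?_⟩⟩
    · have := (hA.1 _ ha ((i : ℕ), f) ⟨by rwa [hval i hi], by
        dsimp only; rwa [hval i hi]⟩).2
      simpa [hval i hi] using this
    · obtain ⟨⟨z, f⟩, hf, hu⟩ := hA.2 ((i : ℕ), y) ⟨by rwa [hval i hi], by
        dsimp only; rwa [hval i hi]⟩
      have hz : z = (i : ℕ) := (sub_eq_zero.1 (hA0 _ hf.2)).symm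
      subst hz
      refine ⟨f, ⟨by simpa [hval i hi] using hf.1.2, by simpa using hf.2⟩, fun f' hf' => ?_⟩
      have := hu ((i : ℕ), f') ⟨⟨by rwa [hval i hi], by
        dsimp only; rw [hval i hi]; exact hf'.1⟩, by simpa using hf'.2⟩
      exact (Prod.ext_iff.1 this).2
  · rintro ⟨A, hA⟩
    refine ⟨{p | p.1 = 0 ∧ p.2 ∈ A}, isTiling_iff.2 ⟨?_, ?_⟩⟩
    · rintro ⟨z, a⟩ ⟨hz, ha⟩ ⟨j, f⟩ ⟨hj, hf⟩
      dsimp only at hz ha hj hf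
      subst hz
      exact ⟨by simpa using hj, by simpa using (isTiling_iff.1 (hA _ hj)).1 a ha f hf⟩
    · rintro ⟨j, y⟩ ⟨hj, hy⟩
      dsimp only at hj hy
      obtain ⟨f, hf, hu⟩ := (isTiling_iff.1 (hA _ hj)).2 y hy
      refine ⟨(j, f), ⟨⟨hj, hf.1⟩, by simp, hf.2⟩, ?_⟩
      rintro ⟨j', f'⟩ ⟨⟨-, hf1⟩, hf2, hf3⟩
      have hz : j = j' := sub_eq_zero.1 hf2
      subst hz
      rw [hu f' ⟨hf1, hf3⟩]

/-! ### Membership constraints -/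

section Membership

variable (X K V : Type*) [AddCommGroup X] [AddCommGroup K] [AddCommGroup V]

/-- The group in which a membership constraint on a function `X → V` is expressed by tiling
equations: a position in `X`, a row and a column index `k₁ k₂ : K`, a mark `(t₁, t₂) : K × K`,
an offset `h : V`, and a value `u : V`. -/
abbrev MarkedGroup : Type _ := X × (K × K) × (K × K) × V × V

variable {X K V}

/-- The tile of the column equation. -/
def columnTile : Set (MarkedGroup X K V) :=
  {y | y.1 = 0 ∧ y.2.1.2 = 0 ∧ y.2.2.1 = 0 ∧ y.2.2.2.1 = 0}

/-- The region of the column equation: the marks allowed in column `k₂` at offset `h`. -/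
def columnRegion : Set (MarkedGroup X K V) :=
  {y | (y.2.2.2.1 = 0 ∧ y.2.2.1.1 = y.2.1.2) ∨
    (y.2.2.2.1 ≠ 0 ∧ y.2.2.1.1 + y.2.2.1.2 = y.2.1.2)}

/-- The tile of the row equation. -/
def rowTile : Set (MarkedGroup X K V) :=
  {y | y.1 = 0 ∧ y.2.1.1 = 0 ∧ y.2.2.1 = 0 ∧ y.2.2.2.2 = 0}

/-- The region of the row equation: the marks allowed in row `k₁` at the value `u`. -/
def rowRegion (S : Set V) : Set (MarkedGroup X K V) :=
  {y | (y.2.2.2.2 ∈ S ∧ y.2.2.1.2 = y.2.1.1) ∨ (y.2.2.2.2 ∉ S ∧ y.2.2.1.1 = y.2.1.1)}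

/-- The tile which imposes the equation of the tile `T ⊆ X × V` on the function `X → V` of each
row index, column index and offset. -/
def liftTile (T : Set (X × V)) : Set (MarkedGroup X K V) :=
  {y | y.2.1 = 0 ∧ y.2.2.2.1 = 0 ∧ (y.1, y.2.2.2.2) ∈ T}

/-- The graph of a function. -/
def graphSet (U : X → V) : Set (X × V) := {p | p.2 = U p.1}

/-- The tile `0 × V`, which imposes that the translates form a graph over `X`. -/
def verticalTile : Set (X × V) := {p | p.1 = 0}

theorem exists_graph_of_isTiling {A : Set (MarkedGroup X K V)}
    (hA : IsTiling A (liftTile verticalTile) Set.univ) (k : K × K) (h : V) (x : X) :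
    ∃ p : (K × K) × V, ∀ t u, (x, k, t, h, u) ∈ A ↔ (t, u) = p := by
  obtain ⟨⟨x', k', t', h', u'⟩, ⟨⟨hk, hh, hx⟩, hf⟩, hu⟩ := (isTiling_iff.1 hA).2
    (x, k, 0, h, 0) trivial
  dsimp only at hk hh
  change x' = 0 at hx
  subst hk hh hx
  refine ⟨(-t', -u'), fun t u => ⟨fun htu => ?_, fun htu => ?_⟩⟩
  · have := hu (0, 0, -t, 0, -u) ⟨⟨rfl, rfl, rfl⟩, by simpa using htu⟩
    simp only [Prod.mk.injEq, true_and] at this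
    rw [← this.1, ← this.2, neg_neg, neg_neg]
  · rw [Prod.mk.injEq] at htu
    rw [htu.1, htu.2]
    simpa using hf

/-- Soundness: the function read off at offset `0`, row `0` and column `s ≠ 0`. If its value at
`x` were outside `S`, the mark there would have to satisfy both `t₁ = s` and `t₁ = 0`. -/
theorem exists_function_of_isTiling [Nontrivial K] {S : Set V} {A : Set (MarkedGroup X K V)}
    (hC : IsTiling A columnTile columnRegion) (hR : IsTiling A rowTile (rowRegion S))
    (hG : IsTiling A (liftTile verticalTile) Set.univ) :
    ∃ U : X → V, (∀ x, U x ∈ S) ∧ ∀ T : Set (X × V), IsTiling A (liftTile T) Set.univ →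
      IsTiling (graphSet U) T Set.univ := by
  obtain ⟨s, hs⟩ := exists_ne (0 : K)
  choose p hp using exists_graph_of_isTiling hG (0, s) 0
  have hpA : ∀ x, (x, (0, s), (p x).1, 0, (p x).2) ∈ A := fun x => (hp x _ _).2 rfl
  refine ⟨fun x => (p x).2, fun x => ?_, fun T hT => ?_⟩
  · have h1 := (isTiling_iff.1 hC).1 _ (hpA x) 0 ⟨rfl, rfl, rfl, rfl⟩
    have h2 := (isTiling_iff.1 hR).1 _ (hpA x) 0 ⟨rfl, rfl, rfl, rfl⟩
    rw [add_zero] at h1 h2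
    rcases h1 with ⟨-, h1⟩ | ⟨h1, -⟩
    · rcases h2 with ⟨h2, -⟩ | ⟨-, h2⟩
      · exact h2
      · exact absurd (h1.symm.trans h2) hs
    · exact absurd rfl h1
  · refine isTiling_iff.2 ⟨fun _ _ _ _ => trivial, ?_⟩
    rintro ⟨x, u⟩ -
    obtain ⟨⟨x', k', t', h', u'⟩, ⟨⟨hk, hh, hx⟩, hf⟩, hu⟩ := (isTiling_iff.1 hT).2
      (x, (0, s), 0, 0, u) trivial
    dsimp only at hk hh hx
    subst hk hh
    refine ⟨(x', u'), ⟨hx, ?_⟩, ?_⟩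
    · have h3 := (hp (x - x') (0 - t') (u - u')).1 (by simpa using hf)
      exact (Prod.ext_iff.1 h3).2
    · rintro ⟨x₁, u₁⟩ ⟨h1, h2⟩
      change u - u₁ = (p (x - x₁)).2 at h2
      have h3 := hpA (x - x₁)
      rw [← h2] at h3
      have := hu (x₁, 0, -(p (x - x₁)).1, 0, u₁) ⟨⟨rfl, rfl, h1⟩, by simpa using h3⟩
      simp only [Prod.mk.injEq] at this
      rw [this.1, this.2.2.2.2]

/-- Completeness: if `U` takes values in `S`, give the offset `h` the function `U + h`; then no
offset and value make both the column and the row region fix the coordinate `t₁`, so that the two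
regions leave exactly one mark for each row and column. -/
theorem exists_isTiling_of_function {S : Set V} {U : X → V} (hU : ∀ x, U x ∈ S) :
    ∃ A : Set (MarkedGroup X K V), IsTiling A columnTile columnRegion ∧
      IsTiling A rowTile (rowRegion S) ∧
      ∀ T : Set (X × V), IsTiling (graphSet U) T Set.univ →
        IsTiling A (liftTile T) Set.univ := by
  refine ⟨{y | y.2.2.2.2 = U y.1 + y.2.2.2.1} ∩ (columnRegion ∩ rowRegion S), ?_, ?_, ?_⟩
  · refine isTiling_iff.2 ⟨?_, ?_⟩
    · rintro a ⟨-, ha, -⟩ f ⟨-, h1, h2, h3⟩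
      simp only [columnRegion, Set.mem_ofPred_eq, Prod.fst_add, Prod.snd_add, h1, h2, h3, add_zero]
      exact ha
    · rintro ⟨x, ⟨k₁, k₂⟩, ⟨t₁, t₂⟩, h, u⟩ hy
      by_cases hS : U x + h ∈ S
      · refine ⟨(0, (k₁ - t₂, 0), 0, 0, u - (U x + h)), ⟨⟨rfl, rfl, rfl, rfl⟩, ?_, ?_, ?_⟩, ?_⟩
        · simp
        · simpa [columnRegion] using hy
        · left; simpa using hS
        · rintro ⟨x', ⟨a, b⟩, t', h', u'⟩ ⟨⟨h1, h2, h3, h4⟩, h5, -, h6⟩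
          dsimp only at h1 h2 h3 h4
          subst h1 h2 h3 h4
          simp only [Prod.mk_sub_mk, sub_zero, Set.mem_ofPred_eq] at h5
          simp only [rowRegion, Prod.mk_sub_mk, sub_zero, Set.mem_ofPred_eq, h5, hS, true_and,
            not_true_eq_false, false_and, or_false] at h6
          rw [h6, ← h5]
          simp
      · refine ⟨(0, (k₁ - t₁, 0), 0, 0, u - (U x + h)), ⟨⟨rfl, rfl, rfl, rfl⟩, ?_, ?_, ?_⟩, ?_⟩
        · simp
        · simpa [columnRegion] using hy
        · right; simpa using hS
        · rintro ⟨x', ⟨a, b⟩, t', h', u'⟩ ⟨⟨h1, h2, h3, h4⟩, h5, -, h6⟩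
          dsimp only at h1 h2 h3 h4
          subst h1 h2 h3 h4
          simp only [Prod.mk_sub_mk, sub_zero, Set.mem_ofPred_eq] at h5
          simp only [rowRegion, Prod.mk_sub_mk, sub_zero, Set.mem_ofPred_eq, h5, hS, true_and,
            not_false_eq_true, false_and, false_or] at h6
          rw [h6, ← h5]
          simp
  · refine isTiling_iff.2 ⟨?_, ?_⟩
    · rintro a ⟨-, -, ha⟩ f ⟨-, h1, h2, h3⟩
      simp only [rowRegion, Set.mem_ofPred_eq, Prod.fst_add, Prod.snd_add, h1, h2, h3, add_zero]
      exact ha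
    · rintro ⟨x, ⟨k₁, k₂⟩, ⟨t₁, t₂⟩, h, u⟩ hy
      by_cases h0 : u - U x = 0
      · refine ⟨(0, (0, k₂ - t₁), 0, h, 0), ⟨⟨rfl, rfl, rfl, rfl⟩, ?_, ?_, ?_⟩, ?_⟩
        · simpa [sub_eq_zero] using h0
        · left; simp
        · simpa [rowRegion] using hy
        · rintro ⟨x', ⟨a, b⟩, t', h', u'⟩ ⟨⟨h1, h2, h3, h4⟩, h5, h6, -⟩
          dsimp only at h1 h2 h3 h4
          subst h1 h2 h3 h4
          simp only [Prod.mk_sub_mk, sub_zero, Set.mem_ofPred_eq] at h5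
          rw [← sub_eq_iff_eq_add', h0] at h5
          simp only [columnRegion, Prod.mk_sub_mk, sub_zero, Set.mem_ofPred_eq, ← h5, true_and,
            ne_eq, not_true_eq_false, false_and, or_false] at h6
          rw [h6, sub_eq_zero.1 h5.symm]
          simp
      · refine ⟨(0, (0, k₂ - (t₁ + t₂)), 0, h - (u - U x), 0),
          ⟨⟨rfl, rfl, rfl, rfl⟩, ?_, ?_, ?_⟩, ?_⟩
        · simp
        · right; simpa using h0
        · simpa [rowRegion] using hy
        · rintro ⟨x', ⟨a, b⟩, t', h', u'⟩ ⟨⟨h1, h2, h3, h4⟩, h5, h6, -⟩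
          dsimp only at h1 h2 h3 h4
          subst h1 h2 h3 h4
          simp only [Prod.mk_sub_mk, sub_zero, Set.mem_ofPred_eq] at h5
          rw [← sub_eq_iff_eq_add'] at h5
          simp only [columnRegion, Prod.mk_sub_mk, sub_zero, Set.mem_ofPred_eq, ← h5, h0, true_and,
            ne_eq, not_false_eq_true, false_and, false_or] at h6
          rw [h6, h5]
          simp
  · intro T hT
    refine isTiling_iff.2 ⟨fun _ _ _ _ => trivial, ?_⟩
    rintro ⟨x, ⟨k₁, k₂⟩, t, h, u⟩ -
    obtain ⟨⟨x', w⟩, ⟨hw, hxw⟩, huniq⟩ := (isTiling_iff.1 hT).2 (x, u - h) trivial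
    change u - h - w = U (x - x') at hxw
    -- the only mark compatible with row `k₁`, column `k₂`, offset `h` and value `u - w`
    obtain ⟨m, hm⟩ : ∃ m : K × K, ∀ t' : K × K,
        ((x - x', (k₁, k₂), t', h, u - w) : MarkedGroup X K V) ∈ columnRegion ∩ rowRegion S ↔
          t' = m := by
      by_cases h0 : h = 0
      · have hS : u - w ∈ S := by
          have := hU (x - x')
          rwa [← hxw, h0, sub_zero] at this
        exact ⟨(k₂, k₁), fun t' => by simp [columnRegion, rowRegion, h0, hS, Prod.ext_iff]⟩
      · by_cases hS : u - w ∈ S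
        · refine ⟨(k₂ - k₁, k₁), fun t' => ⟨fun ⟨h1, h2⟩ => ?_, ?_⟩⟩
          · have h3 : t'.1 + t'.2 = k₂ := (h1.resolve_left fun h1 => h0 h1.1).2
            have h4 : t'.2 = k₁ := (h2.resolve_right fun h2 => h2.1 hS).2
            exact Prod.ext (by rw [← h3, ← h4]; simp) h4
          · rintro rfl
            exact ⟨Or.inr ⟨h0, by simp⟩, Or.inl ⟨hS, rfl⟩⟩
        · refine ⟨(k₁, k₂ - k₁), fun t' => ⟨fun ⟨h1, h2⟩ => ?_, ?_⟩⟩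
          · have h3 : t'.1 + t'.2 = k₂ := (h1.resolve_left fun h1 => h0 h1.1).2
            have h4 : t'.1 = k₁ := (h2.resolve_left fun h2 => hS h2.1).2
            exact Prod.ext h4 (by rw [← h3, ← h4]; simp)
          · rintro rfl
            exact ⟨Or.inr ⟨h0, by simp⟩, Or.inr ⟨hS, rfl⟩⟩
    refine ⟨(x', 0, t - m, 0, w), ⟨⟨rfl, rfl, hw⟩, ?_, ?_⟩, ?_⟩
    · simp only [Prod.mk_sub_mk, sub_zero, Set.mem_ofPred_eq, ← hxw]
      abel
    · simpa using (hm m).2 rfl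
    · rintro ⟨x₁, k₁', t₁, h₁, u₁⟩ ⟨⟨h1, h2, h3⟩, h4, h5⟩
      dsimp only at h1 h2 h3
      subst h1 h2
      simp only [Prod.mk_sub_mk, sub_zero, Set.mem_ofPred_eq] at h4 h5
      have h6 := huniq (x₁, u₁) ⟨h3, by
        change u - h - u₁ = U (x - x₁)
        rw [sub_right_comm, h4, add_sub_cancel_right]⟩
      rw [Prod.mk.injEq] at h6
      obtain ⟨rfl, rfl⟩ := h6
      rw [← (hm _).1 h5]
      simp

end Membership

/-! ### Sudoku puzzles as functional equations -/

section FunctionalEquations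

variable {N : ℕ} {K : Type*} [AddCommGroup K]

/-- The tile which imposes that the `n`-th coordinate is invariant under the translation by
`v`. -/
def invariantTile (v : ℤ × ℤ) (n : Fin N) : Set ((ℤ × ℤ) × (Fin N → K)) :=
  {p | (p.1 = 0 ∧ p.2 n = 0) ∨ (p.1 = v ∧ p.2 n ≠ 0)}

/-- The tile which imposes that the `n`-th coordinate, reduced by `ρ`, takes each value once on
every horizontal segment of length `q`. -/
def permutationTile {R : Type*} [AddCommGroup R] (ρ : K →+ R) (q : ℕ) (n : Fin N) :
    Set ((ℤ × ℤ) × (Fin N → K)) :=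
  {p | ∃ k < q, p.1 = ((k : ℤ), 0) ∧ ρ (p.2 n) = 0}

theorem isTiling_verticalTile {X V : Type*} [AddCommGroup X] [AddCommGroup V] (U : X → V) :
    IsTiling (graphSet U) verticalTile Set.univ := by
  refine isTiling_iff.2 ⟨fun _ _ _ _ => trivial, ?_⟩
  rintro ⟨x, u⟩ -
  refine ⟨(0, u - U x), ⟨rfl, by simp [graphSet]⟩, ?_⟩
  rintro ⟨x', w⟩ ⟨h1, h2⟩
  change x' = 0 at h1
  change u - w = U (x - x') at h2
  subst h1
  rw [sub_zero] at h2
  rw [← h2, sub_sub_cancel]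

theorem isTiling_invariantTile_iff {U : ℤ × ℤ → Fin N → K} {v : ℤ × ℤ} {n : Fin N} :
    IsTiling (graphSet U) (invariantTile v n) Set.univ ↔ ∀ x, U x n = U (x - v) n := by
  rw [isTiling_iff]
  constructor
  · rintro ⟨-, hu⟩ x
    by_contra hne
    have h1 := (hu (x, U x) trivial).unique (y₁ := (0, 0)) (y₂ := (v, U x - U (x - v)))
      ⟨Or.inl ⟨rfl, rfl⟩, by simp [graphSet]⟩
      ⟨Or.inr ⟨rfl, by simpa [sub_eq_zero] using hne⟩, by simp [graphSet]⟩
    have h2 := congrFun (Prod.ext_iff.1 h1).2 n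
    exact hne (sub_eq_zero.1 h2.symm)
  · intro hU
    refine ⟨fun _ _ _ _ => trivial, ?_⟩
    rintro ⟨x, u⟩ -
    by_cases hn : u n = U x n
    · refine ⟨(0, u - U x), ⟨Or.inl ⟨rfl, by simpa [sub_eq_zero] using hn⟩,
        by simp [graphSet]⟩, ?_⟩
      rintro ⟨x', w⟩ ⟨⟨h1, -⟩ | ⟨h1, h2⟩, h3⟩
      · dsimp only at h1
        subst h1
        change u - w = U (x - 0) at h3
        rw [sub_zero] at h3
        rw [← h3, sub_sub_cancel]
      · dsimp only at h1 h2
        subst h1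
        change u - w = U (x - x') at h3
        have := congrFun h3 n
        rw [← hU, ← hn] at this
        simp [h2] at this
    · refine ⟨(v, u - U (x - v)), ⟨Or.inr ⟨rfl, ?_⟩, by simp [graphSet]⟩, ?_⟩
      · simpa [sub_eq_zero, ← hU] using hn
      rintro ⟨x', w⟩ ⟨⟨h1, h2⟩ | ⟨h1, h2⟩, h3⟩
      · dsimp only at h1 h2
        subst h1
        change u - w = U (x - 0) at h3
        rw [sub_zero] at h3
        have := congrFun h3 n
        simp [h2] at this
        exact absurd this hn
      · dsimp only at h1
        subst h1
        change u - w = U (x - x') at h3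
        rw [← h3, sub_sub_cancel]

theorem isTiling_permutationTile_iff {R : Type*} [AddCommGroup R] {ρ : K →+ R} {q : ℕ}
    {U : ℤ × ℤ → Fin N → K} {n : Fin N} :
    IsTiling (graphSet U) (permutationTile ρ q n) Set.univ ↔
      ∀ x a, ∃! k : ℕ, k < q ∧ ρ (U (x - ((k : ℤ), 0)) n) = ρ a := by
  have key : ∀ (x : ℤ × ℤ) (u : Fin N → K) (k : ℕ),
      ρ ((u - U (x - ((k : ℤ), 0))) n) = 0 ↔ ρ (U (x - ((k : ℤ), 0)) n) = ρ (u n) := by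
    intro x u k
    rw [Pi.sub_apply, map_sub, sub_eq_zero, eq_comm]
  rw [isTiling_iff]
  constructor
  · rintro ⟨-, hu⟩ x a
    obtain ⟨⟨x', w⟩, ⟨⟨k, hk, hx, hw⟩, h⟩, huniq⟩ := hu (x, fun _ => a) trivial
    dsimp only at hx hw
    subst hx
    change (fun _ => a) - w = U (x - ((k : ℤ), 0)) at h
    have hw' : w = (fun _ => a) - U (x - ((k : ℤ), 0)) := by rw [← h, sub_sub_cancel]
    subst hw'
    refine ⟨k, ⟨hk, (key _ _ _).1 hw⟩, fun k' hk' => ?_⟩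
    have := huniq (((k' : ℤ), 0), (fun _ => a) - U (x - ((k' : ℤ), 0)))
      ⟨⟨k', hk'.1, rfl, (key _ _ _).2 hk'.2⟩, by simp [graphSet]⟩
    exact Nat.cast_injective (Prod.ext_iff.1 (Prod.ext_iff.1 this).1).1
  · intro hU
    refine ⟨fun _ _ _ _ => trivial, ?_⟩
    rintro ⟨x, u⟩ -
    obtain ⟨k, hk, huniq⟩ := hU x (u n)
    refine ⟨(((k : ℤ), 0), u - U (x - ((k : ℤ), 0))),
      ⟨⟨k, hk.1, rfl, (key _ _ _).2 hk.2⟩, by simp [graphSet]⟩, ?_⟩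
    rintro ⟨x', w⟩ ⟨⟨k', hk', hx, hw⟩, h⟩
    dsimp only at hx hw
    subst hx
    change u - w = U (x - ((k' : ℤ), 0)) at h
    have hw' : w = u - U (x - ((k' : ℤ), 0)) := by rw [← h, sub_sub_cancel]
    subst hw'
    rw [huniq k' ⟨hk', (key _ _ _).1 hw⟩]

end FunctionalEquations

/-- A function which takes every value exactly once on each window of length `q` is periodic and
comes from a permutation of the residues modulo `q`. -/
theorem exists_perm_of_windows {q : ℕ} [NeZero q] {r : ℤ → ZMod q}
    (hr : ∀ m z, ∃! k : ℕ, k < q ∧ r (m - k) = z) :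
    ∃ σ : Equiv.Perm (ZMod q), ∀ m : ℤ, σ m = r m := by
  have hq : 0 < q := NeZero.pos q
  have hper : Function.Periodic r (q : ℤ) := by
    intro m
    obtain ⟨k, ⟨hk, hkr⟩, -⟩ := hr (m + q - 1) (r (m + q))
    -- the value of `r` at the end of a window recurs in the preceding window, at its start
    by_cases hkq : k + 1 < q
    · have := (hr (m + q) (r (m + q))).unique (y₁ := k + 1) (y₂ := 0)
        ⟨hkq, by rw [← hkr]; congr 1; push_cast; ring⟩ ⟨hq, by simp⟩
      omega
    · rw [← hkr]
      congr 1
      omega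
  have hmod : ∀ m : ℤ, r ((m : ZMod q).val) = r m := fun m => by
    rw [ZMod.val_intCast, Int.emod_def, mul_comm]
    simpa using hper.sub_zsmul_eq (m / q) (x := m)
  have hinj : Function.Injective fun z : ZMod q => r z.val := by
    intro z w hzw
    have hz := z.val_lt
    have hw := w.val_lt
    dsimp only at hzw
    have := (hr (q - 1) (r w.val)).unique (y₁ := q - 1 - z.val) (y₂ := q - 1 - w.val)
      ⟨by omega, by rw [← hzw]; congr 1; omega⟩ ⟨by omega, by congr 1; omega⟩
    exact ZMod.val_injective q (by omega)
  exact ⟨Equiv.ofBijective _ (Finite.injective_iff_bijective.1 hinj), hmod⟩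

/-- The values allowed at a position of `ℤ²`: the codes of a member of the rule together with a
choice of residues which conforms to the initial condition. -/
def sudokuValues {N q : ℕ} {Digit K : Type*} (S : SudokuRule N Digit)
    (C : InitialCondition q Digit) (enc : ZMod q × Digit → K) : Set (Fin N → K) :=
  {u | ∃ (s : Fin N → ZMod q) (g : Fin N → Digit),
    g ∈ S ∧ (∀ n, (s n, g n) ∈ C) ∧ u = fun n => enc (s n, g n)}

/-- A Sudoku solution `F` is turned into the function on `ℤ²` which carries at `(i, j)` the
restriction of `F` to the line of slope `-j` through `i`. A function on `ℤ²` is of this form if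
and only if its `n`-th coordinate is invariant under the translation by `(n, 1)`. -/
theorem sudokuSolvable_iff {N q : ℕ} [NeZero q] {Digit K : Type*} [Nonempty Digit]
    [AddCommGroup K] (S : SudokuRule N Digit) (C : InitialCondition q Digit)
    {enc : ZMod q × Digit → K} (henc : Function.Injective enc) {ρ : K →+ ZMod q}
    (hρ : ∀ p, ρ (enc p) = p.1) :
    SudokuSolvable S C ↔ ∃ U : ℤ × ℤ → Fin N → K, (∀ x, U x ∈ sudokuValues S C enc) ∧
      (∀ n x, U x n = U (x - (((n : ℕ) : ℤ), 1)) n) ∧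
      ∀ n x a, ∃! k : ℕ, k < q ∧ ρ (U (x - ((k : ℤ), 0)) n) = ρ a := by
  constructor
  · rintro ⟨F, hS, hC⟩
    choose σ hσ using hC
    refine ⟨fun x n => enc (σ n ((x.1 - x.2 * (n : ℕ) : ℤ) : ZMod q),
      F (n, x.1 - x.2 * (n : ℕ))), fun x => ⟨_, _, ?_, fun n => hσ n _, rfl⟩, fun n x => ?_,
      fun n x a => ?_⟩
    · have := hS (-x.2) x.1
      convert this using 4
      ring
    · have : x.1 - x.2 * (n : ℕ) = (x - (((n : ℕ) : ℤ), 1)).1 -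
          (x - (((n : ℕ) : ℤ), 1)).2 * (n : ℕ) := by
        simp only [Prod.fst_sub, Prod.snd_sub]
        ring
      dsimp only
      rw [← this]
    · simp only [hρ, Prod.fst_sub, Prod.snd_sub, sub_zero]
      have key : ∀ k : ℕ, σ n ((x.1 - k - x.2 * (n : ℕ) : ℤ) : ZMod q) = ρ a ↔
          (k : ZMod q) = ((x.1 - x.2 * (n : ℕ) : ℤ) : ZMod q) - (σ n).symm (ρ a) := by
        intro k
        rw [← Equiv.eq_symm_apply, eq_sub_iff_add_eq, ← eq_sub_iff_add_eq', eq_comm]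
        push_cast
        rw [sub_right_comm]
      simp only [key]
      refine ⟨(((x.1 - x.2 * (n : ℕ) : ℤ) : ZMod q) - (σ n).symm (ρ a)).val,
        ⟨ZMod.val_lt _, ZMod.natCast_zmod_val _⟩, fun k hk => ?_⟩
      rw [← hk.2, ZMod.val_natCast_of_lt hk.1]
  · rintro ⟨U, hU, hinv, hperm⟩
    choose s g hg hsg hUe using hU
    have hline : ∀ n i j, U (i, j) n = U (i - j * (n : ℕ), 0) n := by
      intro n i j
      induction j using Int.induction_on generalizing i with
      | zero => simp
      | succ j ih =>
        rw [hinv, Prod.mk_sub_mk, add_sub_cancel_right, ih]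
        congr 2
        ring
      | pred j ih =>
        have h1 := hinv n (i + (n : ℕ), -j)
        rw [Prod.mk_sub_mk, add_sub_cancel_right] at h1
        rw [← h1, ih]
        congr 2
        ring
    refine ⟨fun p => g (p.2, 0) p.1, fun j i => ?_, fun n => ?_⟩
    · convert hg (i, -j) using 1
      funext n
      have h1 := hline n i (-j)
      rw [hUe, hUe] at h1
      have h2 := (Prod.ext_iff.1 (henc h1)).2
      dsimp only at h2 ⊢
      rw [h2]
      congr 2
      ring
    · obtain ⟨d⟩ := ‹Nonempty Digit›
      obtain ⟨σ, hσ⟩ := exists_perm_of_windows (r := fun m => s (m, 0) n) (fun m z => by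
        simpa [hUe, hρ] using hperm n (m, 0) (enc (z, d)))
      exact ⟨σ, fun m => by rw [hσ]; exact hsg (m, 0) n⟩

/-! ### The algorithm -/

/-- The lists of length `r` with entries smaller than `L`. -/
def boundedLists (L : ℕ) : ℕ → List (List ℕ)
  | 0 => [[]]
  | r + 1 => (List.range L).flatMap fun a => (boundedLists L r).map fun l => a :: l

theorem mem_boundedLists {L r : ℕ} {l : List ℕ} :
    l ∈ boundedLists L r ↔ l.length = r ∧ ∀ a ∈ l, a < L := by
  induction r generalizing l with
  | zero =>
    simp only [boundedLists, List.mem_singleton, List.length_eq_zero_iff]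
    exact ⟨fun h => ⟨h, by simp [h]⟩, fun h => h.1⟩
  | succ r ih =>
    simp only [boundedLists, List.mem_flatMap, List.mem_range, List.mem_map, ih]
    constructor
    · rintro ⟨a, ha, l, ⟨hl, hlt⟩, rfl⟩
      exact ⟨by simp [hl], by simpa using ⟨ha, hlt⟩⟩
    · rintro ⟨hl, hlt⟩
      cases l with
      | nil => simp at hl
      | cons a l =>
        simp only [List.mem_cons, forall_eq_or_imp] at hlt
        exact ⟨a, hlt.1, l, ⟨by simpa using hl, hlt.2⟩, rfl⟩

namespace SudokuCode

variable (c : SudokuCode)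

/-- The common modulus `L` of all the cyclic factors. It is a multiple of the period `q`, at least
`q` times the number of digits, and larger than the number `2 N + 3` of tiling equations. -/
def modulus : ℕ := c.period * (c.numDigits + 2 * c.width + 5)

/-- The number of cyclic factors. Their coordinates are, in this order, the index of the tiling
equation, `k₁`, `k₂`, `t₁`, `t₂`, the `N` coordinates of `h` and the `N` coordinates of `u`. -/
def rank : ℕ := 5 + 2 * c.width

/-- The number `v n = r + q d` stands for the residue `r` and the digit `d`: the residues and
digits conform to the initial condition, and the digits form a member of the rule. -/
def IsAllowed (v : ℕ → ℕ) : Prop :=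
  (∀ n < c.width, v n / c.period < c.numDigits ∧ (v n % c.period, v n / c.period) ∈ c.init) ∧
    (List.range c.width).map (fun n => v n / c.period) ∈ c.rule

/-- All the coordinates of `h` vanish. -/
def OffsetZero (w : ℕ → ℕ) : Prop := ∀ n < c.width, w (5 + n) = 0

/-- All the coordinates of `u` vanish. -/
def ValueZero (w : ℕ → ℕ) : Prop := ∀ n < c.width, w (5 + c.width + n) = 0

/-- The point with coordinates `w` belongs to the region. -/
def InRegion (w : ℕ → ℕ) : Prop :=
  w 0 < 2 * c.width + 3 ∧
    (w 0 ≠ 0 ∨ (c.OffsetZero w ∧ w 3 = w 2) ∨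
      (¬ c.OffsetZero w ∧ (w 3 + w 4) % c.modulus = w 2)) ∧
    (w 0 ≠ 1 ∨ (c.IsAllowed (fun n => w (5 + c.width + n)) ∧ w 4 = w 1) ∨
      (¬ c.IsAllowed (fun n => w (5 + c.width + n)) ∧ w 3 = w 1))

/-- The point with position `(a, b)` and coordinates `w` belongs to the tile of the invariance
equation or of the permutation equation of the `n`-th column of the Sudoku board. -/
def InColumnTile (a b : ℕ) (w : ℕ → ℕ) (n : ℕ) : Prop :=
  (w 0 = 3 + n ∧ ((a = 0 ∧ b = 0 ∧ w (5 + c.width + n) = 0) ∨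
    (a = n ∧ b = 1 ∧ w (5 + c.width + n) ≠ 0))) ∨
  (w 0 = 3 + c.width + n ∧ a < c.period ∧ b = 0 ∧ w (5 + c.width + n) % c.period = 0)

/-- The point with position `(a, b)` and coordinates `w` belongs to the tile. -/
def InTile (a b : ℕ) (w : ℕ → ℕ) : Prop :=
  (w 0 = 0 ∧ a = 0 ∧ b = 0 ∧ w 2 = 0 ∧ w 3 = 0 ∧ w 4 = 0 ∧ c.OffsetZero w) ∨
  (w 0 = 1 ∧ a = 0 ∧ b = 0 ∧ w 1 = 0 ∧ w 3 = 0 ∧ w 4 = 0 ∧ c.ValueZero w) ∨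
  (w 1 = 0 ∧ w 2 = 0 ∧ c.OffsetZero w ∧
    ((w 0 = 2 ∧ a = 0 ∧ b = 0) ∨ ∃ n < c.width, c.InColumnTile a b w n))

open Classical in
/-- The list of the elements of the region. -/
noncomputable def regionList : List (List ℕ) :=
  (boundedLists c.modulus c.rank).filter fun l => c.InRegion fun i => l.getD i 0

open Classical in
/-- The list of the elements of the tile. A candidate is written as a list starting with the two
coordinates of the position. -/
noncomputable def tileList : List ((ℤ × ℤ) × List ℕ) :=
  ((boundedLists c.modulus (c.rank + 2)).filter fun l =>
    c.InTile (l.getD 0 0) (l.getD 1 0) fun i => l.getD (2 + i) 0).map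
      fun l => (((l.getD 0 0 : ℕ), (l.getD 1 0 : ℕ)), l.drop 2)

/-- The tiling problem which expresses the Sudoku puzzle. -/
noncomputable def toTilingCode : TilingCode where
  moduli := List.replicate c.rank c.modulus
  region := c.regionList
  tile := c.tileList

end SudokuCode

section Primrec

variable {α : Type*} [Primcodable α]

theorem PrimrecPred.forall_lt_bound {f : α → ℕ} {p : α → ℕ → Prop} (hf : Primrec f)
    (hp : PrimrecPred fun x : α × ℕ => p x.1 x.2) : PrimrecPred fun a => ∀ n < f a, p a n :=
  have h : PrimrecRel fun (n : ℕ) (a : α) => p a n := hp.comp (Primrec.pair .snd .fst)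
  (h.forall_mem_list.comp (Primrec.list_range.comp hf) .id).of_eq fun a => by simp

theorem PrimrecPred.exists_lt_bound {f : α → ℕ} {p : α → ℕ → Prop} (hf : Primrec f)
    (hp : PrimrecPred fun x : α × ℕ => p x.1 x.2) : PrimrecPred fun a => ∃ n < f a, p a n :=
  have h : PrimrecRel fun (n : ℕ) (a : α) => p a n := hp.comp (Primrec.pair .snd .fst)
  (h.exists_mem_list.comp (Primrec.list_range.comp hf) .id).of_eq fun a => by simp

theorem PrimrecPred.mem_list {β : Type*} [Primcodable β] {f : α → β} {g : α → List β}
    (hf : Primrec f) (hg : Primrec g) : PrimrecPred fun a => f a ∈ g a :=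
  ((Primrec.eq (α := β)).exists_mem_list.comp hg hf).of_eq fun a => by simp

theorem Primrec.int_natCast : Primrec ((↑) : ℕ → ℤ) :=
  Primrec.encode_iff.1 ((Primrec.nat_double).of_eq fun _ => rfl)

theorem primrec_boundedLists : Primrec₂ boundedLists := by
  have h : Primrec₂ fun (L : ℕ) (p : ℕ × List (List ℕ)) =>
      (List.range L).flatMap fun a => p.2.map fun l => a :: l :=
    .list_flatMap (Primrec.list_range.comp .fst)
      (Primrec.list_map (Primrec.snd.comp (Primrec.snd.comp .fst))
        (Primrec.list_cons.comp (Primrec.snd.comp .fst) .snd).to₂).to₂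
  refine (Primrec.nat_rec (Primrec.const [[]]) h).of_eq fun L r => ?_
  induction r with
  | zero => rfl
  | succ r ih => simp only [boundedLists, ← ih]

namespace SudokuCode

theorem primrec_tuple : Primrec equivTuple := Primrec.of_equiv

theorem primrec_width : Primrec width := Primrec.fst.comp primrec_tuple

theorem primrec_numDigits : Primrec numDigits :=
  Primrec.fst.comp (Primrec.snd.comp primrec_tuple)

theorem primrec_period : Primrec period :=
  Primrec.fst.comp (Primrec.snd.comp (Primrec.snd.comp primrec_tuple))

theorem primrec_rule : Primrec rule :=
  Primrec.fst.comp (Primrec.snd.comp (Primrec.snd.comp (Primrec.snd.comp primrec_tuple)))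

theorem primrec_init : Primrec init :=
  Primrec.snd.comp (Primrec.snd.comp (Primrec.snd.comp (Primrec.snd.comp primrec_tuple)))

theorem primrec_modulus : Primrec modulus :=
  Primrec.nat_mul.comp primrec_period (Primrec.nat_add.comp (Primrec.nat_add.comp
    primrec_numDigits (Primrec.nat_mul.comp (.const 2) primrec_width)) (.const 5))

theorem primrec_rank : Primrec rank :=
  Primrec.nat_add.comp (.const 5) (Primrec.nat_mul.comp (.const 2) primrec_width)

variable {c : α → SudokuCode} {w : α → ℕ → ℕ}

/-- Evaluation of a primitive recursive family of coordinate functions. -/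
theorem primrec_coord (hw : Primrec₂ w) {i : α → ℕ} (hi : Primrec i) :
    Primrec fun x => w x (i x) := hw.comp .id hi

theorem primrecPred_coord_eq (hw : Primrec₂ w) (i j : ℕ) : PrimrecPred fun x => w x i = j :=
  Primrec.eq.comp (primrec_coord hw (.const i)) (.const j)

theorem primrecPred_offsetZero (hc : Primrec c) (hw : Primrec₂ w) :
    PrimrecPred fun x => (c x).OffsetZero (w x) :=
  .forall_lt_bound (primrec_width.comp hc) (Primrec.eq.comp
    (hw.comp .fst (Primrec.nat_add.comp (.const 5) .snd)) (.const 0))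

theorem primrec₂_valueCoord (hc : Primrec c) (hw : Primrec₂ w) :
    Primrec₂ fun x n => w x (5 + (c x).width + n) :=
  hw.comp₂ .left (Primrec.nat_add.comp₂ (Primrec.nat_add.comp₂ (.const 5)
    (primrec_width.comp (hc.comp .fst)).to₂) .right)

theorem primrecPred_valueZero (hc : Primrec c) (hw : Primrec₂ w) :
    PrimrecPred fun x => (c x).ValueZero (w x) :=
  .forall_lt_bound (primrec_width.comp hc) (Primrec.eq.comp
    (primrec₂_valueCoord hc hw) (.const 0))

theorem primrecPred_isAllowed (hc : Primrec c) {v : α → ℕ → ℕ} (hv : Primrec₂ v) :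
    PrimrecPred fun x => (c x).IsAllowed (v x) := by
  have hp : Primrec fun y : α × ℕ => (c y.1).period := primrec_period.comp (hc.comp .fst)
  have hd : Primrec₂ fun x n => v x n / (c x).period := Primrec.nat_div.comp hv hp
  have hm : Primrec₂ fun x n => v x n % (c x).period := Primrec.nat_mod.comp hv hp
  refine .and (.forall_lt_bound (primrec_width.comp hc) (.and ?_ ?_)) (.mem_list ?_ ?_)
  · exact Primrec.nat_lt.comp hd (primrec_numDigits.comp (hc.comp .fst))
  · exact .mem_list (Primrec.pair hm hd) (primrec_init.comp (hc.comp .fst))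
  · exact .list_map (Primrec.list_range.comp (primrec_width.comp hc)) hd
  · exact primrec_rule.comp hc

theorem primrecPred_inRegion (hc : Primrec c) (hw : Primrec₂ w) :
    PrimrecPred fun x => (c x).InRegion (w x) := by
  have hi : ∀ i, Primrec fun x => w x i := fun i => primrec_coord hw (.const i)
  have h0 := primrecPred_offsetZero hc hw
  have hS := primrecPred_isAllowed hc (primrec₂_valueCoord hc hw)
  refine .and (Primrec.nat_lt.comp (hi 0) (Primrec.nat_add.comp (Primrec.nat_mul.comp (.const 2)
    (primrec_width.comp hc)) (.const 3))) (.and (.or (primrecPred_coord_eq hw 0 0).not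
      (.or (.and h0 ?_) (.and h0.not ?_))) (.or (primrecPred_coord_eq hw 0 1).not
      (.or (.and hS ?_) (.and hS.not ?_))))
  · exact Primrec.eq.comp (hi 3) (hi 2)
  · exact Primrec.eq.comp (Primrec.nat_mod.comp (Primrec.nat_add.comp (hi 3) (hi 4))
      (primrec_modulus.comp hc)) (hi 2)
  · exact Primrec.eq.comp (hi 4) (hi 1)
  · exact Primrec.eq.comp (hi 3) (hi 1)

theorem primrecPred_inColumnTile (hc : Primrec c) (hw : Primrec₂ w) {a b n : α → ℕ}
    (ha : Primrec a) (hb : Primrec b) (hn : Primrec n) :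
    PrimrecPred fun x => (c x).InColumnTile (a x) (b x) (w x) (n x) := by
  have h0 : Primrec fun x => w x 0 := primrec_coord hw (.const 0)
  have hu : Primrec fun x => w x (5 + (c x).width + n x) :=
    (primrec₂_valueCoord hc hw).comp .id hn
  have hp := primrec_period.comp hc
  have eq0 : ∀ {f : α → ℕ}, Primrec f → PrimrecPred fun x => f x = 0 := fun hf =>
    Primrec.eq.comp hf (.const 0)
  refine .or (.and ?_ (.or (.and (eq0 ha) (.and (eq0 hb) (eq0 hu)))
    (.and (Primrec.eq.comp ha hn) (.and (Primrec.eq.comp hb (.const 1)) (eq0 hu).not))))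
    (.and ?_ (.and (Primrec.nat_lt.comp ha hp) (.and (eq0 hb) (eq0 (Primrec.nat_mod.comp hu hp)))))
  · exact Primrec.eq.comp h0 (Primrec.nat_add.comp (.const 3) hn)
  · exact Primrec.eq.comp h0 (Primrec.nat_add.comp (Primrec.nat_add.comp (.const 3)
      (primrec_width.comp hc)) hn)

theorem primrecPred_inTile (hc : Primrec c) (hw : Primrec₂ w) {a b : α → ℕ}
    (ha : Primrec a) (hb : Primrec b) :
    PrimrecPred fun x => (c x).InTile (a x) (b x) (w x) := by
  have hi := primrecPred_coord_eq hw
  have ha0 : PrimrecPred fun x => a x = 0 := Primrec.eq.comp ha (.const 0)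
  have hb0 : PrimrecPred fun x => b x = 0 := Primrec.eq.comp hb (.const 0)
  have h0 := primrecPred_offsetZero hc hw
  have hu := primrecPred_valueZero hc hw
  refine .or (.and (hi 0 0) (.and ha0 (.and hb0 (.and (hi 2 0) (.and (hi 3 0)
    (.and (hi 4 0) h0)))))) (.or (.and (hi 0 1) (.and ha0 (.and hb0 (.and (hi 1 0)
    (.and (hi 3 0) (.and (hi 4 0) hu)))))) (.and (hi 1 0) (.and (hi 2 0) (.and h0
    (.or (.and (hi 0 2) (.and ha0 hb0)) (.exists_lt_bound (primrec_width.comp hc) ?_))))))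
  exact primrecPred_inColumnTile (hc.comp .fst) (hw.comp₂ (Primrec.fst.comp .fst).to₂ .right)
    (ha.comp .fst) (hb.comp .fst) .snd

theorem primrec_regionList : Primrec regionList := by
  classical
  have hR : PrimrecRel fun (l : List ℕ) (c : SudokuCode) =>
      c.InRegion fun i => l.getD i 0 :=
    primrecPred_inRegion Primrec.snd
      ((Primrec.list_getD 0).comp (Primrec.fst.comp .fst) .snd).to₂
  exact (hR.listFilter.comp (primrec_boundedLists.comp primrec_modulus primrec_rank) .id).of_eq
    fun c => by simp only [regionList, id]

theorem primrec_tileList : Primrec tileList := by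
  classical
  have hd : ∀ i, Primrec fun l : List ℕ => l.getD i 0 := fun i =>
    (Primrec.list_getD 0).comp .id (.const i)
  have hR : PrimrecRel fun (l : List ℕ) (c : SudokuCode) =>
      c.InTile (l.getD 0 0) (l.getD 1 0) fun i => l.getD (2 + i) 0 :=
    primrecPred_inTile Primrec.snd
      ((Primrec.list_getD 0).comp (Primrec.fst.comp .fst)
        (Primrec.nat_add.comp (.const 2) .snd)).to₂
      ((hd 0).comp .fst) ((hd 1).comp .fst)
  have hm : Primrec fun l : List ℕ =>
      ((((l.getD 0 0 : ℕ) : ℤ), ((l.getD 1 0 : ℕ) : ℤ)), l.drop 2) :=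
    .pair (.pair (Primrec.int_natCast.comp (hd 0)) (Primrec.int_natCast.comp (hd 1)))
      (Primrec.list_drop.comp (.const 2) .id)
  have hf := hR.listFilter.comp (primrec_boundedLists.comp primrec_modulus
    (Primrec.nat_add.comp primrec_rank (.const 2))) .id
  exact (Primrec.list_map hf (hm.comp .snd).to₂).of_eq fun c => by simp only [tileList, id]

theorem computable_toTilingCode : Computable toTilingCode := by
  refine Primrec.to_comp ((Primrec.of_equiv_iff TilingCode.equivTuple).1 ?_)
  refine .pair ?_ (.pair primrec_regionList primrec_tileList)
  refine (Primrec.list_map (Primrec.list_range.comp primrec_rank)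
    (primrec_modulus.comp .fst).to₂).of_eq fun c => ?_
  simp [toTilingCode]

end SudokuCode

end Primrec

/-! ### The tiling equations of a Sudoku puzzle -/

section Equations

variable {N : ℕ} {K : Type*} [AddCommGroup K]

/-- The tile of the `i`-th tiling equation, for `i < 2 N + 3`. -/
def equationTile {R : Type*} [AddCommGroup R] (ρ : K →+ R) (q i : ℕ) :
    Set (MarkedGroup (ℤ × ℤ) K (Fin N → K)) :=
  {y | (i = 0 ∧ y ∈ columnTile) ∨ (i = 1 ∧ y ∈ rowTile) ∨
    (i = 2 ∧ y ∈ liftTile verticalTile) ∨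
    ∃ n : Fin N, (i = 3 + n ∧ y ∈ liftTile (invariantTile (((n : ℕ) : ℤ), 1) n)) ∨
      (i = 3 + N + n ∧ y ∈ liftTile (permutationTile ρ q n))}

/-- The region of the `i`-th tiling equation. -/
def equationRegion (S : Set (Fin N → K)) (i : ℕ) : Set (MarkedGroup (ℤ × ℤ) K (Fin N → K)) :=
  {y | (i ≠ 0 ∨ y ∈ columnRegion) ∧ (i ≠ 1 ∨ y ∈ rowRegion S)}

theorem forall_isTiling_equation_iff {R : Type*} [AddCommGroup R] (ρ : K →+ R) (q : ℕ)
    (S : Set (Fin N → K)) (A : Set (MarkedGroup (ℤ × ℤ) K (Fin N → K))) :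
    (∀ i < 2 * N + 3, IsTiling A (equationTile ρ q i) (equationRegion S i)) ↔
      IsTiling A columnTile columnRegion ∧ IsTiling A rowTile (rowRegion S) ∧
      IsTiling A (liftTile verticalTile) Set.univ ∧
      ∀ n : Fin N, IsTiling A (liftTile (invariantTile (((n : ℕ) : ℤ), 1) n)) Set.univ ∧
        IsTiling A (liftTile (permutationTile ρ q n)) Set.univ := by
  have e0 : equationTile (N := N) ρ q 0 = columnTile := by
    ext y; simp [equationTile]; omega
  have e1 : equationTile (N := N) ρ q 1 = rowTile := by
    ext y; simp [equationTile]; omega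
  have e2 : equationTile (N := N) ρ q 2 = liftTile verticalTile := by
    ext y; simp [equationTile]; omega
  have e3 : ∀ n : Fin N, equationTile (N := N) ρ q (3 + n) =
      liftTile (invariantTile (((n : ℕ) : ℤ), 1) n) := by
    intro n
    ext y
    constructor
    · rintro (⟨h, -⟩ | ⟨h, -⟩ | ⟨h, -⟩ | ⟨m, ⟨h, hy⟩ | ⟨h, -⟩⟩)
      · omega
      · omega
      · omega
      · obtain rfl : n = m := Fin.ext (by omega)
        exact hy
      · omega
    · exact fun hy => Or.inr (Or.inr (Or.inr ⟨n, Or.inl ⟨rfl, hy⟩⟩))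
  have e4 : ∀ n : Fin N, equationTile (N := N) ρ q (3 + N + n) =
      liftTile (permutationTile ρ q n) := by
    intro n
    ext y
    constructor
    · rintro (⟨h, -⟩ | ⟨h, -⟩ | ⟨h, -⟩ | ⟨m, ⟨h, -⟩ | ⟨h, hy⟩⟩)
      · omega
      · omega
      · omega
      · omega
      · obtain rfl : n = m := Fin.ext (by omega)
        exact hy
    · exact fun hy => Or.inr (Or.inr (Or.inr ⟨n, Or.inr ⟨rfl, hy⟩⟩))
  have r0 : equationRegion S 0 = columnRegion := by ext y; simp [equationRegion]
  have r1 : equationRegion S 1 = rowRegion S := by ext y; simp [equationRegion]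
  have r2 : ∀ i, equationRegion S (2 + i) = Set.univ := by
    intro i
    ext y
    simp only [equationRegion, Set.mem_univ, iff_true]
    exact ⟨Or.inl (by omega), Or.inl (by omega)⟩
  have r3 : ∀ i, equationRegion S (3 + i) = Set.univ := fun i => by
    rw [← r2 (1 + i)]; congr 1; omega
  constructor
  · intro h
    refine ⟨by simpa [e0, r0] using h 0, by simpa [e1, r1] using h 1 (by omega),
      by simpa [e2, r2 0] using h 2 (by omega), fun n => ⟨?_, ?_⟩⟩
    · simpa only [e3, r3] using h (3 + n) (by omega)
    · have := h (3 + N + n) (by omega)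
      rwa [e4, add_assoc, r3] at this
  · rintro ⟨h0, h1, h2, h3⟩ i hi
    by_cases hi0 : i = 0
    · rwa [hi0, e0, r0]
    by_cases hi1 : i = 1
    · rwa [hi1, e1, r1]
    by_cases hi2 : i = 2
    · rw [hi2, e2, r2 0]; exact h2
    by_cases hi3 : i < 3 + N
    · obtain ⟨n, rfl⟩ : ∃ n : Fin N, i = 3 + n := ⟨⟨i - 3, by omega⟩, by simp; omega⟩
      rw [e3, r3]
      exact (h3 n).1
    · obtain ⟨n, rfl⟩ : ∃ n : Fin N, i = 3 + N + n :=
        ⟨⟨i - (3 + N), by omega⟩, by simp; omega⟩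
      rw [e4, add_assoc, r3]
      exact (h3 n).2

theorem zero_mem_equationTile {R : Type*} [AddCommGroup R] (ρ : K →+ R) {q i : ℕ} (hq : 0 < q)
    (hi : i < 2 * N + 3) : 0 ∈ equationTile (N := N) ρ q i := by
  by_cases hi0 : i = 0
  · exact Or.inl ⟨hi0, rfl, rfl, rfl, rfl⟩
  by_cases hi1 : i = 1
  · exact Or.inr (Or.inl ⟨hi1, rfl, rfl, rfl, rfl⟩)
  by_cases hi2 : i = 2
  · exact Or.inr (Or.inr (Or.inl ⟨hi2, rfl, rfl, rfl⟩))
  refine Or.inr (Or.inr (Or.inr ?_))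
  by_cases hi3 : i < 3 + N
  · exact ⟨⟨i - 3, by omega⟩, Or.inl ⟨by simp; omega, rfl, rfl, Or.inl ⟨rfl, rfl⟩⟩⟩
  · exact ⟨⟨i - (3 + N), by omega⟩, Or.inr ⟨by simp; omega, rfl, rfl, 0, hq, rfl, by simp⟩⟩

theorem sudokuSolvable_iff_exists_isTiling [Nontrivial K] {q : ℕ} [NeZero q] {Digit : Type*}
    [Nonempty Digit] (S : SudokuRule N Digit) (C : InitialCondition q Digit)
    {enc : ZMod q × Digit → K} (henc : Function.Injective enc) {ρ : K →+ ZMod q}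
    (hρ : ∀ p, ρ (enc p) = p.1) :
    SudokuSolvable S C ↔ ∃ A, ∀ i < 2 * N + 3,
      IsTiling A (equationTile ρ q i) (equationRegion (sudokuValues S C enc) i) := by
  simp only [sudokuSolvable_iff S C henc hρ, forall_isTiling_equation_iff]
  constructor
  · rintro ⟨U, hU, hinv, hperm⟩
    obtain ⟨A, hC, hR, hT⟩ := exists_isTiling_of_function (K := K) hU
    exact ⟨A, hC, hR, hT _ (isTiling_verticalTile U), fun n =>
      ⟨hT _ (isTiling_invariantTile_iff.2 (hinv n)),
        hT _ (isTiling_permutationTile_iff.2 (hperm n))⟩⟩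
  · rintro ⟨A, hC, hR, hG, h⟩
    obtain ⟨U, hU, hT⟩ := exists_function_of_isTiling hC hR hG
    exact ⟨U, hU, fun n => isTiling_invariantTile_iff.1 (hT _ (h n).1),
      fun n => isTiling_permutationTile_iff.1 (hT _ (h n).2)⟩

end Equations

/-! ### Coordinates -/

/-- The arrangement of `5 + 2 N` coordinates as the index of the tiling equation, the row and
column indices, the marks, the offset and the value. -/
def coordinateEquiv (N : ℕ) (K : Type*) [AddCommGroup K] :
    (Fin (5 + 2 * N) → K) ≃+ K × (K × K) × (K × K) × (Fin N → K) × (Fin N → K) where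
  toFun g := (g ⟨0, by omega⟩, (g ⟨1, by omega⟩, g ⟨2, by omega⟩),
    (g ⟨3, by omega⟩, g ⟨4, by omega⟩), fun n => g ⟨5 + n, by omega⟩,
    fun n => g ⟨5 + N + n, by omega⟩)
  invFun p i :=
    if h : (i : ℕ) < 5 then ![p.1, p.2.1.1, p.2.1.2, p.2.2.1.1, p.2.2.1.2] ⟨i, h⟩
    else if h' : (i : ℕ) < 5 + N then p.2.2.2.1 ⟨i - 5, by omega⟩
    else p.2.2.2.2 ⟨i - (5 + N), by omega⟩
  left_inv g := by
    funext ⟨i, hi⟩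
    dsimp only
    split_ifs with h h'
    · interval_cases i <;> rfl
    · congr 2; omega
    · congr 2; omega
  right_inv p := by
    obtain ⟨e, ⟨k₁, k₂⟩, ⟨t₁, t₂⟩, h, u⟩ := p
    simp only [Prod.mk.injEq]
    refine ⟨rfl, ⟨rfl, rfl⟩, ⟨rfl, rfl⟩, ?_, ?_⟩
    · funext n
      rw [dif_neg (by omega), dif_pos (by omega)]
      congr 1
      ext
      simp
    · funext n
      rw [dif_neg (by omega), dif_neg (by omega)]
      congr 1
      ext
      simp
  map_add' _ _ := rfl

/-- The group `G₀` of a list of `r` equal moduli. -/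
theorem TilingCode.exists_equiv_of_moduli_eq {t : TilingCode} {r L : ℕ}
    (h : t.moduli = List.replicate r L) : ∃ φ : t.G₀ ≃+ (Fin r → ZMod L),
      ∀ l i, φ (t.element l) i = ((l.getD i 0 : ℕ) : ZMod L) := by
  have hr : t.moduli.length = r := by simp [h]
  have hL : ∀ i, t.moduli.get i = L := fun i => by simp [h]
  refine ⟨{ toFun := fun g i =>
              ZMod.ringEquivCongr (hL (Fin.cast hr.symm i)) (g (Fin.cast hr.symm i))
            invFun := fun g i => (ZMod.ringEquivCongr (hL i)).symm (g (Fin.cast hr i))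
            left_inv := fun g => funext fun i => RingEquiv.symm_apply_apply _ _
            right_inv := fun g => funext fun i => RingEquiv.apply_symm_apply _ _
            map_add' := fun g g' => funext fun i => map_add _ _ _ }, fun l i => ?_⟩
  exact map_natCast (ZMod.ringEquivCongr (hL (Fin.cast hr.symm i))) _

/-- The element with coordinates `w`. -/
def cell (L N : ℕ) (w : ℕ → ℕ) : ZMod L × (ZMod L × ZMod L) × (ZMod L × ZMod L) ×
    (Fin N → ZMod L) × (Fin N → ZMod L) :=
  (w 0, (w 1, w 2), (w 3, w 4), fun n => w (5 + n), fun n => w (5 + N + n))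

theorem TilingCode.exists_equiv_cell {t : TilingCode} {N L : ℕ}
    (h : t.moduli = List.replicate (5 + 2 * N) L) :
    ∃ ψ : t.G₀ ≃+ ZMod L × (ZMod L × ZMod L) × (ZMod L × ZMod L) × (Fin N → ZMod L) ×
      (Fin N → ZMod L), ∀ l, ψ (t.element l) = cell L N fun i => l.getD i 0 := by
  obtain ⟨φ, hφ⟩ := t.exists_equiv_of_moduli_eq h
  refine ⟨φ.trans (coordinateEquiv N (ZMod L)), fun l => ?_⟩
  simp only [AddEquiv.trans_apply, coordinateEquiv, AddEquiv.coe_mk, Equiv.coe_fn_mk, hφ, cell]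

section Cell

variable {L : ℕ}

theorem ZMod.natCast_inj_of_lt {a b : ℕ} (ha : a < L) (hb : b < L) :
    (a : ZMod L) = b ↔ a = b := by
  rw [ZMod.natCast_eq_natCast_iff', Nat.mod_eq_of_lt ha, Nat.mod_eq_of_lt hb]

theorem ZMod.natCast_eq_zero_of_lt {a : ℕ} (ha : a < L) : (a : ZMod L) = 0 ↔ a = 0 := by
  rw [← Nat.cast_zero, ZMod.natCast_inj_of_lt ha (by omega)]

theorem getD_lt_of_mem_boundedLists {r : ℕ} (hL : 0 < L) {l : List ℕ}
    (hl : l ∈ boundedLists L r) (i : ℕ) :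
    l.getD i 0 < L := by
  rw [List.getD_eq_getElem?_getD]
  by_cases h : i < l.length
  · simpa [h] using (mem_boundedLists.1 hl).2 _ (List.getElem_mem h)
  · simpa [h] using hL

end Cell

theorem TilingCode.exists_element_eq {t : TilingCode} {r L : ℕ} (hL : 0 < L)
    (h : t.moduli = List.replicate r L) (g : t.G₀) : ∃ l ∈ boundedLists L r, g = t.element l := by
  have : NeZero L := ⟨by omega⟩
  obtain ⟨φ, hφ⟩ := t.exists_equiv_of_moduli_eq h
  refine ⟨List.ofFn fun i => (φ g i).val, mem_boundedLists.2 ⟨by simp, fun a ha => ?_⟩,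
    φ.injective (funext fun i => ?_)⟩
  · obtain ⟨i, rfl⟩ := (List.mem_ofFn' _ _).1 ha
    exact ZMod.val_lt _
  · rw [hφ, List.getD_eq_getElem _ _ (by simp), List.getElem_ofFn, ZMod.natCast_zmod_val]

theorem TilingCode.element_injOn {t : TilingCode} {r L : ℕ}
    (h : t.moduli = List.replicate r L) {l l' : List ℕ} (hl : l ∈ boundedLists L r)
    (hl' : l' ∈ boundedLists L r) (he : t.element l = t.element l') : l = l' := by
  obtain ⟨φ, hφ⟩ := t.exists_equiv_of_moduli_eq h
  rw [mem_boundedLists] at hl hl'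
  refine List.ext_getElem (hl.1.trans hl'.1.symm) fun i hi hi' => ?_
  have := congrFun (congrArg φ he) ⟨i, hl.1 ▸ hi⟩
  rw [hφ, hφ, List.getD_eq_getElem _ _ hi, List.getD_eq_getElem _ _ hi',
    ZMod.natCast_inj_of_lt (hl.2 _ (List.getElem_mem hi)) (hl'.2 _ (List.getElem_mem hi'))] at this
  exact this

/-! ### Correctness of the algorithm -/

namespace SudokuCode

variable {c : SudokuCode}

/-- The code of a residue and a digit in `ℤ/Lℤ`. -/
def encodePair (c : SudokuCode) {Digit : Type*} (e : Digit ≃ Fin c.numDigits)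
    (p : ZMod c.period × Digit) : ZMod c.modulus :=
  ((p.1.val + c.period * (e p.2 : ℕ) : ℕ) : ZMod c.modulus)

/-- The reduction of `ℤ/Lℤ` modulo the period. -/
def residueHom (c : SudokuCode) : ZMod c.modulus →+ ZMod c.period :=
  (ZMod.castHom (Dvd.intro _ rfl) (ZMod c.period)).toAddMonoidHom

theorem residueHom_natCast (a : ℕ) : c.residueHom (a : ZMod c.modulus) = a :=
  map_natCast (ZMod.castHom (Dvd.intro _ rfl) (ZMod c.period)) a

theorem period_mul_le_modulus {k : ℕ} (hk : k ≤ c.numDigits + 2 * c.width + 5) :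
    c.period * k ≤ c.modulus :=
  Nat.mul_le_mul_left _ hk

theorem le_modulus (hq : 0 < c.period) : c.numDigits + 2 * c.width + 5 ≤ c.modulus :=
  Nat.le_mul_of_pos_left _ hq

section Encoding

variable {Digit : Type*} (e : Digit ≃ Fin c.numDigits) [NeZero c.period]

theorem encodePair_lt (p : ZMod c.period × Digit) :
    p.1.val + c.period * (e p.2 : ℕ) < c.modulus :=
  calc p.1.val + c.period * (e p.2 : ℕ) < c.period + c.period * (e p.2 : ℕ) :=
        Nat.add_lt_add_right (ZMod.val_lt _) _
    _ = c.period * (e p.2 + 1) := by ring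
    _ ≤ c.modulus := period_mul_le_modulus (by have := (e p.2).isLt; omega)

theorem encodePair_injective : Function.Injective (c.encodePair e) := by
  rintro ⟨r, d⟩ ⟨r', d'⟩ h
  have h1 := (ZMod.natCast_inj_of_lt (encodePair_lt e (r, d)) (encodePair_lt e (r', d'))).1 h
  have hr : r.val = r'.val := by
    have := congrArg (· % c.period) h1
    simpa [Nat.mod_eq_of_lt (ZMod.val_lt _)] using this
  rw [hr, Nat.add_left_cancel_iff] at h1
  exact Prod.ext (ZMod.val_injective _ hr)
    (e.injective (Fin.ext (Nat.eq_of_mul_eq_mul_left (NeZero.pos c.period) h1)))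

theorem residueHom_encodePair (p : ZMod c.period × Digit) :
    c.residueHom (c.encodePair e p) = p.1 := by
  rw [encodePair, residueHom_natCast]
  simp

theorem mem_sudokuValues_iff {S : SudokuRule c.width Digit}
    {C : InitialCondition c.period Digit}
    (hS : ∀ g : Fin c.width → Digit, g ∈ S ↔ List.ofFn (fun n => (e (g n) : ℕ)) ∈ c.rule)
    (hC : ∀ (r : ZMod c.period) (d : Digit), (r, d) ∈ C ↔ (r.val, (e d : ℕ)) ∈ c.init)
    {v : ℕ → ℕ} (hv : ∀ n, v n < c.modulus) :
    (fun n : Fin c.width => (v n : ZMod c.modulus)) ∈ sudokuValues S C (c.encodePair e) ↔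
      c.IsAllowed v := by
  have hlist : ∀ f : ℕ → ℕ, (List.range c.width).map f =
      List.ofFn fun n : Fin c.width => f n := fun f => by
    rw [List.ofFn_eq_map, ← List.map_coe_finRange_eq_range, List.map_map]
    rfl
  rw [IsAllowed, hlist]
  constructor
  · rintro ⟨s, g, hg, hsg, h⟩
    have key : ∀ n : Fin c.width, v n = (s n).val + c.period * (e (g n) : ℕ) := fun n =>
      (ZMod.natCast_inj_of_lt (hv _) (encodePair_lt e (s n, g n))).1 (congrFun h n)
    have hmod : ∀ n : Fin c.width, v n % c.period = (s n).val := fun n => by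
      rw [key, Nat.add_mul_mod_self_left, Nat.mod_eq_of_lt (ZMod.val_lt _)]
    have hdiv : ∀ n : Fin c.width, v n / c.period = e (g n) := fun n => by
      rw [key, Nat.add_mul_div_left _ _ (NeZero.pos _), Nat.div_eq_of_lt (ZMod.val_lt _),
        zero_add]
    refine ⟨fun n hn => ?_, ?_⟩
    · rw [hmod ⟨n, hn⟩, hdiv ⟨n, hn⟩]
      exact ⟨(e _).isLt, (hC _ _).1 (hsg _)⟩
    · simpa only [hdiv] using (hS g).1 hg
  · rintro ⟨h1, h2⟩
    refine ⟨fun n => ((v n % c.period : ℕ) : ZMod c.period),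
      fun n => e.symm ⟨v n / c.period, (h1 n n.isLt).1⟩, ?_, fun n => ?_, funext fun n => ?_⟩
    · rw [hS]
      simpa using h2
    · rw [hC, ZMod.val_natCast_of_lt (Nat.mod_lt _ (NeZero.pos _))]
      simpa using (h1 n n.isLt).2
    · rw [encodePair, ZMod.val_natCast_of_lt (Nat.mod_lt _ (NeZero.pos _))]
      simp only [Equiv.apply_symm_apply, Nat.mod_add_div]

end Encoding

section Points

variable {w : ℕ → ℕ}

theorem offset_eq_zero_iff (hw : ∀ i, w i < c.modulus) :
    (fun n : Fin c.width => (w (5 + n) : ZMod c.modulus)) = 0 ↔ c.OffsetZero w := by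
  simp only [funext_iff, Pi.zero_apply, ZMod.natCast_eq_zero_of_lt (hw _), OffsetZero]
  exact ⟨fun h n hn => h ⟨n, hn⟩, fun h n => h n n.isLt⟩

theorem value_eq_zero_iff (hw : ∀ i, w i < c.modulus) :
    (fun n : Fin c.width => (w (5 + c.width + n) : ZMod c.modulus)) = 0 ↔ c.ValueZero w := by
  simp only [funext_iff, Pi.zero_apply, ZMod.natCast_eq_zero_of_lt (hw _), ValueZero]
  exact ⟨fun h n hn => h ⟨n, hn⟩, fun h n => h n n.isLt⟩

theorem cell_mem_equationRegion_iff {V : Set (Fin c.width → ZMod c.modulus)}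
    (hw : ∀ i, w i < c.modulus) (hV : (fun n : Fin c.width =>
      (w (5 + c.width + n) : ZMod c.modulus)) ∈ V ↔ c.IsAllowed fun n => w (5 + c.width + n))
    (x : ℤ × ℤ) :
    ((cell c.modulus c.width w).1.val < 2 * c.width + 3 ∧
      (x, (cell c.modulus c.width w).2) ∈
        equationRegion V (cell c.modulus c.width w).1.val) ↔ c.InRegion w := by
  have hsum : (w 3 : ZMod c.modulus) + w 4 = w 2 ↔ (w 3 + w 4) % c.modulus = w 2 := by
    rw [← Nat.cast_add, ZMod.natCast_eq_natCast_iff', Nat.mod_eq_of_lt (hw 2)]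
  simp only [cell, equationRegion, columnRegion, rowRegion, InRegion, Set.mem_ofPred_eq,
    ZMod.val_natCast_of_lt (hw _), hV, offset_eq_zero_iff hw, ne_eq, hsum,
    ZMod.natCast_inj_of_lt (hw _) (hw _)]

theorem cell_mem_equationTile_iff (hw : ∀ i, w i < c.modulus) (a b : ℕ) :
    ((cell c.modulus c.width w).1.val < 2 * c.width + 3 ∧
      (((a : ℤ), (b : ℤ)), (cell c.modulus c.width w).2) ∈
        equationTile c.residueHom c.period (cell c.modulus c.width w).1.val) ↔
      c.InTile a b w := by
  have hpos : (((a : ℤ), (b : ℤ)) = 0) ↔ a = 0 ∧ b = 0 := by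
    rw [Prod.mk_eq_zero, Nat.cast_eq_zero, Nat.cast_eq_zero]
  have hlift : ∀ T : Set ((ℤ × ℤ) × (Fin c.width → ZMod c.modulus)),
      ((((a : ℤ), (b : ℤ)), (cell c.modulus c.width w).2) ∈ liftTile T ↔
        (w 1 = 0 ∧ w 2 = 0) ∧ c.OffsetZero w ∧
          (((a : ℤ), (b : ℤ)), fun n : Fin c.width =>
            (w (5 + c.width + n) : ZMod c.modulus)) ∈ T) := by
    intro T
    simp only [cell, liftTile, Set.mem_ofPred_eq, Prod.mk_eq_zero, offset_eq_zero_iff hw,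
      ZMod.natCast_eq_zero_of_lt (hw _)]
  have hinv : ∀ n : Fin c.width, (((a : ℤ), (b : ℤ)), fun n : Fin c.width =>
      (w (5 + c.width + n) : ZMod c.modulus)) ∈ invariantTile (((n : ℕ) : ℤ), 1) n ↔
      (a = 0 ∧ b = 0 ∧ w (5 + c.width + n) = 0) ∨
        (a = n ∧ b = 1 ∧ w (5 + c.width + n) ≠ 0) := by
    intro n
    simp only [invariantTile, Set.mem_ofPred_eq, hpos, ne_eq,
      ZMod.natCast_eq_zero_of_lt (hw _), Prod.mk.injEq, Nat.cast_inj, Nat.cast_eq_one, and_assoc]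
  have hperm : ∀ n : Fin c.width, (((a : ℤ), (b : ℤ)), fun n : Fin c.width =>
      (w (5 + c.width + n) : ZMod c.modulus)) ∈ permutationTile c.residueHom c.period n ↔
      a < c.period ∧ b = 0 ∧ w (5 + c.width + n) % c.period = 0 := by
    intro n
    simp only [permutationTile, Set.mem_ofPred_eq, residueHom_natCast, Prod.mk.injEq,
      Nat.cast_inj, Nat.cast_eq_zero, ZMod.natCast_eq_zero_iff, Nat.dvd_iff_mod_eq_zero]
    constructor
    · rintro ⟨k, hk, ⟨rfl, hb⟩, h⟩
      exact ⟨hk, hb, h⟩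
    · rintro ⟨ha, hb, h⟩
      exact ⟨a, ha, ⟨rfl, hb⟩, h⟩
  have hcol : (((a : ℤ), (b : ℤ)), (cell c.modulus c.width w).2) ∈ columnTile ↔
      a = 0 ∧ b = 0 ∧ w 2 = 0 ∧ w 3 = 0 ∧ w 4 = 0 ∧ c.OffsetZero w := by
    simp only [cell, columnTile, Set.mem_ofPred_eq, hpos, Prod.mk_eq_zero,
      offset_eq_zero_iff hw, ZMod.natCast_eq_zero_of_lt (hw _), and_assoc]
  have hrow : (((a : ℤ), (b : ℤ)), (cell c.modulus c.width w).2) ∈ rowTile ↔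
      a = 0 ∧ b = 0 ∧ w 1 = 0 ∧ w 3 = 0 ∧ w 4 = 0 ∧ c.ValueZero w := by
    simp only [cell, rowTile, Set.mem_ofPred_eq, hpos, Prod.mk_eq_zero,
      value_eq_zero_iff hw, ZMod.natCast_eq_zero_of_lt (hw _), and_assoc]
  have hval : (cell c.modulus c.width w).1.val = w 0 := ZMod.val_natCast_of_lt (hw 0)
  have hvert : (((a : ℤ), (b : ℤ)), fun n : Fin c.width =>
      (w (5 + c.width + n) : ZMod c.modulus)) ∈ verticalTile ↔ a = 0 ∧ b = 0 := hpos
  rw [hval, equationTile, Set.mem_ofPred_eq, hcol, hrow]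
  simp only [hlift, hinv, hperm, hvert, InTile, InColumnTile]
  constructor
  · rintro ⟨-, h | h | ⟨h, hk, ho, hx⟩ | ⟨n, ⟨h, hk, ho, hx⟩ | ⟨h, hk, ho, hx⟩⟩⟩
    · exact Or.inl h
    · exact Or.inr (Or.inl h)
    · exact Or.inr (Or.inr ⟨hk.1, hk.2, ho, Or.inl ⟨h, hx⟩⟩)
    · exact Or.inr (Or.inr ⟨hk.1, hk.2, ho, Or.inr ⟨n, n.isLt, Or.inl ⟨h, hx⟩⟩⟩)
    · exact Or.inr (Or.inr ⟨hk.1, hk.2, ho, Or.inr ⟨n, n.isLt, Or.inr ⟨h, hx⟩⟩⟩)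
  · rintro (h | h | ⟨h1, h2, ho, ⟨h, hx⟩ | ⟨n, hn, ⟨h, hx⟩ | ⟨h, hx⟩⟩⟩)
    · exact ⟨by omega, Or.inl h⟩
    · exact ⟨by omega, Or.inr (Or.inl h)⟩
    · exact ⟨by omega, Or.inr (Or.inr (Or.inl ⟨h, ⟨h1, h2⟩, ho, hx⟩))⟩
    · exact ⟨by omega, Or.inr (Or.inr (Or.inr ⟨⟨n, hn⟩, Or.inl ⟨h, ⟨h1, h2⟩, ho, hx⟩⟩))⟩
    · exact ⟨by omega, Or.inr (Or.inr (Or.inr ⟨⟨n, hn⟩, Or.inr ⟨h, ⟨h1, h2⟩, ho, hx⟩⟩))⟩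

/-- The positions of the tile lie in the box searched by the algorithm. -/
theorem exists_position (hq : 0 < c.period) {i : ℕ}
    {y : MarkedGroup (ℤ × ℤ) (ZMod c.modulus) (Fin c.width → ZMod c.modulus)}
    (hy : y ∈ equationTile c.residueHom c.period i) :
    ∃ a < c.modulus, ∃ b < c.modulus, y.1 = ((a : ℤ), (b : ℤ)) := by
  have hL := le_modulus hq
  have hpL : c.period ≤ c.modulus := by
    simpa using period_mul_le_modulus (c := c) (k := 1) (by omega)
  rcases hy with ⟨-, h, -⟩ | ⟨-, h, -⟩ | ⟨-, -, -, h⟩ | ⟨n, ⟨-, -, -, ⟨h, -⟩ | ⟨h, -⟩⟩ |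
    ⟨-, -, -, k, hk, h, -⟩⟩
  · exact ⟨0, by omega, 0, by omega, h⟩
  · exact ⟨0, by omega, 0, by omega, h⟩
  · exact ⟨0, by omega, 0, by omega, h⟩
  · exact ⟨0, by omega, 0, by omega, h⟩
  · exact ⟨n, by omega, 1, by omega, h⟩
  · exact ⟨k, by omega, 0, by omega, h⟩

theorem mem_regionList {l : List ℕ} : l ∈ c.regionList ↔
    l ∈ boundedLists c.modulus c.rank ∧ c.InRegion fun i => l.getD i 0 := by
  simp [regionList]

theorem mem_tileList {p : (ℤ × ℤ) × List ℕ} : p ∈ c.tileList ↔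
    ∃ a < c.modulus, ∃ b < c.modulus, ∃ l ∈ boundedLists c.modulus c.rank,
      c.InTile a b (fun i => l.getD i 0) ∧ p = (((a : ℤ), (b : ℤ)), l) := by
  have hcons : ∀ (a b : ℕ) (l : List ℕ) (i : ℕ), (a :: b :: l).getD (2 + i) 0 = l.getD i 0 :=
    fun a b l i => by rw [add_comm]; rfl
  simp only [tileList, List.mem_map, List.mem_filter, decide_eq_true_eq]
  constructor
  · rintro ⟨l, ⟨hl, ht⟩, rfl⟩
    simp only [boundedLists, List.mem_flatMap, List.mem_map, List.mem_range] at hl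
    obtain ⟨a, ha, l, ⟨b, hb, l, hl, rfl⟩, rfl⟩ := hl
    simp only [hcons] at ht
    exact ⟨a, ha, b, hb, l, hl, ht, rfl⟩
  · rintro ⟨a, ha, b, hb, l, hl, ht, rfl⟩
    refine ⟨a :: b :: l, ⟨?_, ?_⟩, rfl⟩
    · simp only [boundedLists, List.mem_flatMap, List.mem_map, List.mem_range]
      exact ⟨a, ha, b :: l, ⟨b, hb, l, hl, rfl⟩, rfl⟩
    · simp only [hcons]
      exact ht

end Points

theorem sudokuSolvable_iff_tiles [NeZero c.period] {Digit : Type*} [Nonempty Digit]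
    {S : SudokuRule c.width Digit} {C : InitialCondition c.period Digit}
    (e : Digit ≃ Fin c.numDigits)
    (hS : ∀ g : Fin c.width → Digit, g ∈ S ↔ List.ofFn (fun n => (e (g n) : ℕ)) ∈ c.rule)
    (hC : ∀ (r : ZMod c.period) (d : Digit), (r, d) ∈ C ↔ (r.val, (e d : ℕ)) ∈ c.init) :
    SudokuSolvable S C ↔ Tiles c.toTilingCode.F
      ((Set.univ : Set (ℤ × ℤ)) ×ˢ c.toTilingCode.E) := by
  have hq : 0 < c.period := NeZero.pos _
  have hle := le_modulus hq
  have hL : 0 < c.modulus := by omega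
  have : Fact (1 < c.modulus) := ⟨by omega⟩
  have hmod : c.toTilingCode.moduli = List.replicate (5 + 2 * c.width) c.modulus := rfl
  obtain ⟨ψ, hψ⟩ := TilingCode.exists_equiv_cell hmod
  -- the rearrangement of the coordinates which puts the index of the tiling equation first
  let Φ : ((ℤ × ℤ) × c.toTilingCode.G₀) ≃+ ZMod c.modulus ×
      MarkedGroup (ℤ × ℤ) (ZMod c.modulus) (Fin c.width → ZMod c.modulus) :=
    { toFun := fun p => ((ψ p.2).1, (p.1, (ψ p.2).2))
      invFun := fun p => (p.2.1, ψ.symm (p.1, p.2.2))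
      left_inv := fun p => by simp
      right_inv := fun p => by simp
      map_add' := fun p p' => by simp }
  rw [sudokuSolvable_iff_exists_isTiling S C (encodePair_injective e) (residueHom_encodePair e),
    ← tiles_layers_iff (L := c.modulus) (by omega) (by omega) _ _
      (fun i hi => zero_mem_equationTile _ hq hi), ← tiles_preimage_iff Φ]
  have hF : Φ ⁻¹' {p | p.1.val < 2 * c.width + 3 ∧
      p.2 ∈ equationTile c.residueHom c.period p.1.val} = c.toTilingCode.F := by
    ext ⟨x, g⟩
    obtain ⟨l, hl, rfl⟩ := TilingCode.exists_element_eq hL hmod g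
    change (ψ _).1.val < _ ∧ (x, (ψ _).2) ∈ equationTile _ _ (ψ _).1.val ↔ _
    rw [hψ]
    constructor
    · rintro ⟨h1, h2⟩
      obtain ⟨a, ha, b, hb, hx⟩ := exists_position hq h2
      dsimp only at hx
      subst hx
      exact ⟨(((a : ℤ), (b : ℤ)), l), mem_tileList.2 ⟨a, ha, b, hb, l, hl,
        (cell_mem_equationTile_iff (getD_lt_of_mem_boundedLists hL hl) a b).1 ⟨h1, h2⟩, rfl⟩, rfl⟩
    · rintro ⟨p, hp, hx⟩
      obtain ⟨a, -, b, -, l', hl', ht, rfl⟩ := mem_tileList.1 hp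
      rw [Prod.mk.injEq] at hx
      obtain ⟨rfl, hx⟩ := hx
      rw [TilingCode.element_injOn hmod hl hl' hx]
      exact (cell_mem_equationTile_iff (getD_lt_of_mem_boundedLists hL hl') a b).2 ht
  have hE : Φ ⁻¹' {p | p.1.val < 2 * c.width + 3 ∧
      p.2 ∈ equationRegion (sudokuValues S C (c.encodePair e)) p.1.val} =
        (Set.univ : Set (ℤ × ℤ)) ×ˢ c.toTilingCode.E := by
    ext ⟨x, g⟩
    obtain ⟨l, hl, rfl⟩ := TilingCode.exists_element_eq hL hmod g
    change (ψ _).1.val < _ ∧ (x, (ψ _).2) ∈ equationRegion _ (ψ _).1.val ↔ _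
    have hw := getD_lt_of_mem_boundedLists hL hl
    rw [hψ, cell_mem_equationRegion_iff hw (mem_sudokuValues_iff e hS hC fun n => hw _),
      Set.mem_prod]
    constructor
    · exact fun h => ⟨trivial, l, mem_regionList.2 ⟨hl, h⟩, rfl⟩
    · rintro ⟨-, l', hl', hx⟩
      obtain ⟨hl'', h⟩ := mem_regionList.1 hl'
      rw [TilingCode.element_injOn hmod hl hl'' hx]
      exact h
  rw [hF, hE]

end SudokuCode

theorem TilingCode.finite_F (t : TilingCode) : t.F.Finite :=
  (t.tile.finite_toSet.image fun p => (p.1, t.element p.2)).subset fun _ ⟨p, hp, hx⟩ =>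
    ⟨p, hp, hx.symm⟩

theorem mainTheorem4 :
    ∃ encode : SudokuCode → TilingCode, Computable encode ∧
      ∀ (N q : ℕ) (_ : 1 ≤ q) (Digit : Type*) [Finite Digit] [Nonempty Digit]
        (S : SudokuRule N Digit) (C : InitialCondition q Digit) (c : SudokuCode),
        c.Describes S C →
          Finite (encode c).G₀ ∧ (encode c).F.Finite ∧
            (SudokuSolvable S C ↔
              Tiles (encode c).F ((Set.univ : Set (ℤ × ℤ)) ×ˢ (encode c).E)) := by
  refine ⟨SudokuCode.toTilingCode, SudokuCode.computable_toTilingCode, ?_⟩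
  rintro N q hq Digit _ _ S C c ⟨rfl, rfl, e, hS, hC⟩
  have : NeZero c.period := ⟨by omega⟩
  have hL := SudokuCode.le_modulus hq
  have : NeZero c.modulus := ⟨by omega⟩
  obtain ⟨φ, -⟩ := c.toTilingCode.exists_equiv_of_moduli_eq rfl
  exact ⟨Finite.of_equiv _ φ.symm.toEquiv, TilingCode.finite_F _,
    SudokuCode.sudokuSolvable_iff_tiles e hS hC⟩
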